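/- Let $\mathbb K$ be a field of characteristic $0$, let $n\ge 2$, and let $(L,[\cdot,\dots,\cdot],\alpha)$ be a multiplicative $n$-Hom-Leibniz algebra over $\mathbb K$: $L$ is a vector space, $[\cdot,\dots,\cdot]:L^{\otimes n}\to L$ and $\alpha:L\to L$ are linear, $\alpha[x_1,\dots,x_n]=[\alpha x_1,\dots,\alpha x_n]$, and $$[[x_1,\dots,x_n],\alpha y_1,\dots,\alpha y_{n-1}]=\sum_{i=1}^n[\alpha x_1,\dots,\alpha x_{i-1},[x_i,y_1,\dots,y_{n-1}],\alpha x_{i+1},\dots,\alpha x_n].$$ Assume that $\alpha$ is injective. **Notation.** Put $\mathcal D=L^{\otimes(n-1)}$, $\bar\alpha=\alpha^{\otimes(n-1)}$, and for $X=X^1\otimes\cdots\otimes X^{n-1}$, $Y\in\mathcal D$, $z\in L$ put $[z,X]=[z,X^1,\dots,X^{n-1}]$ and $[X,Y]=\sum_s\alpha X^1\otimes\cdots\otimes[X^s,Y]\otimes\cdots\otimes\alpha X^{n-1}$ (extended linearly). For $p\ge0$ let $\Gamma^p(L)=C^{p+1}(L,L)$ be the space of linear maps $f:L\otimes\mathcal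 D^{\otimes p}\to L$ with $\alpha\circ f=f\circ(\alpha\otimes\bar\alpha^{\otimes p})$. The coboundary $\delta:\Gamma^p(L)\to\Gamma^{p+1}(L)$ is $$\begin{aligned}\delta f(z,X_1,\dots,X_{p+1})={}&\sum_{1\le i<j\le p+1}(-1)^jf(\alpha z,\bar\alpha X_1,\dots,\bar\alpha X_{i-1},[X_i,X_j],\bar\alpha X_{i+1},\dots,\widehat{X_j},\dots,\bar\alpha X_{p+1})\\&+\sum_{i=1}^{p+1}(-1)^if([z,X_i],\bar\alpha X_1,\dots,\widehat{X_i},\dots,\bar\alpha X_{p+1})\\&+\sum_{i=1}^{p+1}(-1)^{i+1}[f(z,X_1,\dots,\widehat{X_i},\dots,X_{p+1}),\bar\alpha^{p}X_i]\\&+\sum_{s=1}^{n-1}[\alpha^pz,\alpha^pX_1^1,\dots,\alpha^pX_1^{s-1},f(X_1^s,X_2,\dots,X_{p+1}),\alpha^pX_1^{s+1},\dots,\alpha^pX_1^{n-1}].\end{aligned}$$ Let $H^{p+1}(L,L)=\mathcal Z^{p+1}/\mathcal B^{p+1}$, where $\mathcal Z^{p+1}=\ker(\delta|_{\Gamma^p(L)})$,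 $\mathcal B^{p+1}=\delta(\Gamma^{p-1}(L))$ for $p\ge1$, and $\mathcal B^1=0$. For $f\in\Gamma^p(L)$, $g\in\Gamma^q(L)$, $0\le k\le p$ and a $(q,p-k)$-shuffle $\sigma$ of $\{k+1,\dots,p+q\}$ let $$f\circ_0^\sigma g(z,X_1,\dots,X_{p+q})=f(g(z,X_{\sigma(1)},\dots,X_{\sigma(q)}),\bar\alpha^qX_{\sigma(q+1)},\dots,\bar\alpha^qX_{\sigma(p+q)})$$ and, for $k\ge1$, $$\begin{aligned}f\circ_k^\sigma g(z,X_1,\dots,X_{p+q})=\sum_{s=1}^{n-1}f\big(&\alpha^qz,\bar\alpha^qX_1,\dots,\bar\alpha^qX_{k-1},\ \alpha^qX_k^1\otimes\cdots\otimes g(X_k^s,X_{\sigma(k+1)},\dots,X_{\sigma(k+q)})\otimes\cdots\otimes\alpha^qX_k^{n-1},\\&\bar\alpha^qX_{\sigma(k+q+1)},\dots,\bar\alpha^qX_{\sigma(p+q)}\big).\end{aligned}$$ Put $i_f(g)=\sum_{k=0}^p(-1)^{kq}\sum_{\sigma\in Sh(q,p-k)}\epsilon(\sigma)\,f\circ_k^\sigma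 g$ and $$[f,g]_{\mathcal N}=i_f(g)+(-1)^{pq+1}i_g(f)\in\Gamma^{p+q}(L).$$ **Theorem.** 1. $[\cdot,\cdot]_{\mathcal N}$ makes $\Gamma^*(L)$ a graded Lie algebra: it is bilinear and, for $f\in\Gamma^p(L)$, $g\in\Gamma^q(L)$, $h\in\Gamma^r(L)$, one has $[f,g]_{\mathcal N}=-(-1)^{pq}[g,f]_{\mathcal N}$ and $$(-1)^{pr}[[f,g]_{\mathcal N},h]_{\mathcal N}+(-1)^{qp}[[g,h]_{\mathcal N},f]_{\mathcal N}+(-1)^{rq}[[h,f]_{\mathcal N},g]_{\mathcal N}=0.$$ 2. $\delta\circ\delta=0$, and for $f\in\Gamma^p(L)$, $g\in\Gamma^q(L)$, $$\delta[f,g]_{\mathcal N}=(-1)^{q}[\delta f,g]_{\mathcal N}+[f,\delta g]_{\mathcal N}.$$ 3. The bracket of two cocycles is a cocycle, and $[\cdot,\cdot]_{\mathcal N}$ induces a well-defined bracket $H^{p+1}(L,L)\times H^{q+1}(L,L)\to H^{p+q+1}(L,L)$ (that is, of degree $-1$ on $H^*(L,L)$), which makes $H^*(L,L)$ a graded Lie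 algebra, with $H^{p+1}(L,L)$ placed in degree $p$: bilinearity, the graded antisymmetry and the graded Jacobi identity of item 1 hold for it. -/

import Mathlib

open scoped TensorProduct

noncomputable section

/-- A multiplicative (right) `n`-Hom-Leibniz algebra structure on `L`, where `n = m + 1`, with all
twisting maps equal to a single linear map `α`. -/
structure NHomLeibniz (K L : Type*) [Field K] [AddCommGroup L] [Module K L] (m : ℕ) where
  /-- the twisting map -/
  α : L →ₗ[K] L
  /-- the `n`-ary bracket, `n = m + 1` -/
  bracket : MultilinearMap K (fun _ : Fin (m + 1) => L) L
  /-- `[[x₁,…,xₙ], α y₁,…,α yₙ₋₁] = ∑ᵢ [α x₁,…,α xᵢ₋₁, [xᵢ, y₁,…,yₙ₋₁], α xᵢ₊₁,…,α xₙ]` -/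
  leibniz : ∀ (x : Fin (m + 1) → L) (y : Fin m → L),
    bracket (Fin.cons (bracket x) (fun i => α (y i)) : Fin (m + 1) → L) =
      ∑ i : Fin (m + 1), bracket
        (Function.update (fun j => α (x j)) i (bracket (Fin.cons (x i) y : Fin (m + 1) → L)))
  /-- multiplicativity: `α [x₁,…,xₙ] = [α x₁,…,α xₙ]` -/
  map_bracket : ∀ x : Fin (m + 1) → L, α (bracket x) = bracket (fun i => α (x i))

namespace NHomLeibniz

/-- `𝒟ₙ₋₁(L) = L^{⊗ (n-1)}`, with `m = n - 1`. -/
abbrev D (K L : Type*) [Field K] [AddCommGroup L] [Module K L] (m : ℕ) : Type _ :=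
  PiTensorProduct K (fun _ : Fin m => L)

/-- Linear maps `f : L ⊗ 𝒟ₙ₋₁(L)^{⊗ p} → L`, in curried form: `f X z` stands for
`f (z, X₁, …, X_p)`, so the variable `X i` (`i : Fin p`) is `X_{i+1}`. -/
abbrev PreCochain (K L : Type*) [Field K] [AddCommGroup L] [Module K L] (m p : ℕ) : Type _ :=
  MultilinearMap K (fun _ : Fin p => D K L m) (Module.End K L)

variable {K L : Type*} [Field K] [AddCommGroup L] [Module K L] {m : ℕ}

/-- The currying identification: linear maps on `L ⊗ 𝒟ₙ₋₁(L)^{⊗ p}` are the pre-cochains. -/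
def curryEquiv (p : ℕ) :
    (L ⊗[K] (PiTensorProduct K (fun _ : Fin p => D K L m)) →ₗ[K] L) ≃ₗ[K] PreCochain K L m p :=
  ((TensorProduct.lift.equiv (RingHom.id K) L
      (PiTensorProduct K (fun _ : Fin p => D K L m)) L).symm.trans LinearMap.lflip).trans
    PiTensorProduct.lift.symm

theorem curryEquiv_apply (p : ℕ)
    (F : L ⊗[K] (PiTensorProduct K (fun _ : Fin p => D K L m)) →ₗ[K] L)
    (X : Fin p → D K L m) (z : L) :
    curryEquiv p F X z = F (z ⊗ₜ[K] PiTensorProduct.tprod K X) := rfl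

/-- For linear maps `β, φ : L → L`, the map on `𝒟ₙ₋₁(L)` given by
`x₁ ⊗ ⋯ ⊗ xₙ₋₁ ↦ ∑ₛ β x₁ ⊗ ⋯ ⊗ β xₛ₋₁ ⊗ φ xₛ ⊗ β xₛ₊₁ ⊗ ⋯ ⊗ β xₙ₋₁` (linear in `φ`). -/
def insertion (β : Module.End K L) :
    Module.End K L →ₗ[K] Module.End K (D K L m) :=
  ∑ s : Fin m, (PiTensorProduct.mapMultilinear K (fun _ : Fin m => L)
    (fun _ : Fin m => L)).toLinearMap (fun _ => β) s

theorem insertion_tprod (β φ : Module.End K L) (x : Fin m → L) :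
    insertion β φ (PiTensorProduct.tprod K x) =
      ∑ s : Fin m, PiTensorProduct.tprod K (Function.update (fun t => β (x t)) s (φ (x s))) := by
  simp only [insertion, LinearMap.sum_apply, MultilinearMap.toLinearMap_apply,
    PiTensorProduct.mapMultilinear_apply, PiTensorProduct.map_tprod]
  refine Finset.sum_congr rfl fun s _ => congrArg _ (funext fun t => ?_)
  by_cases h : t = s
  · subst h; simp
  · simp [h]

/-! Auxiliary facts used to see that the formulas below are multilinear. -/

/-- `F` is multilinear, in the form convenient for building multilinear maps. -/
def IsML {N : ℕ} {V W : Type*} [AddCommGroup V] [Module K V] [AddCommGroup W] [Module K W]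
    (F : (Fin N → W) → V) : Prop :=
  ∀ X i, ∃ Ψ : W →ₗ[K] V, ∀ a, F (Function.update X i a) = Ψ a

/-- The multilinear map with underlying function `F`. -/
def mkML {N : ℕ} {V W : Type*} [AddCommGroup V] [Module K V] [AddCommGroup W] [Module K W]
    (F : (Fin N → W) → V) (h : IsML (K := K) F) : MultilinearMap K (fun _ : Fin N => W) V :=
  MultilinearMap.mk' F
    (fun X i a b => by obtain ⟨Ψ, hΨ⟩ := h X i; simp [hΨ])
    (fun X i c a => by obtain ⟨Ψ, hΨ⟩ := h X i; simp [hΨ])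

theorem mkML_apply {N : ℕ} {V W : Type*} [AddCommGroup V] [Module K V] [AddCommGroup W]
    [Module K W] (F : (Fin N → W) → V) (h : IsML (K := K) F) (X : Fin N → W) :
    mkML F h X = F X := rfl

theorem IsML.add {N : ℕ} {V W : Type*} [AddCommGroup V] [Module K V] [AddCommGroup W]
    [Module K W] {F G : (Fin N → W) → V} (hF : IsML (K := K) F) (hG : IsML (K := K) G) :
    IsML (K := K) (fun X => F X + G X) := fun X i => by
  obtain ⟨Ψ, h⟩ := hF X i
  obtain ⟨Φ, h'⟩ := hG X i
  exact ⟨Ψ + Φ, fun a => by simp [h, h']⟩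

theorem IsML.zsmul {N : ℕ} {V W : Type*} [AddCommGroup V] [Module K V] [AddCommGroup W]
    [Module K W] {F : (Fin N → W) → V} (c : ℤ) (hF : IsML (K := K) F) :
    IsML (K := K) (fun X => c • F X) := fun X i => by
  obtain ⟨Ψ, h⟩ := hF X i
  exact ⟨c • Ψ, fun a => by simp [h]⟩

theorem IsML.sum {N : ℕ} {V W ι : Type*} [AddCommGroup V] [Module K V] [AddCommGroup W]
    [Module K W] (s : Finset ι) {F : ι → (Fin N → W) → V} (hF : ∀ i ∈ s, IsML (K := K) (F i)) :
    IsML (K := K) (fun X => ∑ i ∈ s, F i X) := fun X i => by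
  classical
  have h : ∀ j : s, ∃ Ψ : W →ₗ[K] V, ∀ a, F j (Function.update X i a) = Ψ a :=
    fun j => hF j j.2 X i
  choose Ψ hΨ using h
  refine ⟨∑ j : s, Ψ j, fun a => ?_⟩
  rw [LinearMap.sum_apply]
  refine (Finset.sum_coe_sort s fun j => F j (Function.update X i a)).symm.trans ?_
  exact Finset.sum_congr rfl fun j _ => hΨ j a

/-- A single slot `l` of `f` depends linearly on `a`. -/
theorem slot_linear {P : ℕ} {V W : Type*} [AddCommGroup V] [Module K V] [AddCommGroup W]
    [Module K W] (f : MultilinearMap K (fun _ : Fin P => W) V) (Y : W → Fin P → W) (l : Fin P)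
    (φ : W →ₗ[K] W) (hl : ∀ a, Y a l = φ a) (hne : ∀ a j, j ≠ l → Y a j = Y 0 j) :
    ∃ Ψ : W →ₗ[K] V, ∀ a, f (Y a) = Ψ a := by
  refine ⟨f.toLinearMap (Y 0) l ∘ₗ φ, fun a => ?_⟩
  rw [LinearMap.comp_apply, MultilinearMap.toLinearMap_apply]
  congr 1
  funext j
  by_cases h : j = l
  · subst h; simp [hl]
  · simp [h, hne a j h]

theorem exists_mul_right {W : Type*} [AddCommGroup W] [Module K W] {F : W → Module.End K L}
    (h : ∃ Ψ : W →ₗ[K] Module.End K L, ∀ a, F a = Ψ a) (u : Module.End K L) :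
    ∃ Ψ : W →ₗ[K] Module.End K L, ∀ a, F a ∘ₗ u = Ψ a := by
  obtain ⟨Ψ, h⟩ := h
  exact ⟨LinearMap.mulRight K u ∘ₗ Ψ, fun a => by rw [h]; rfl⟩

theorem exists_mul_left {W : Type*} [AddCommGroup W] [Module K W] {F : W → Module.End K L}
    (h : ∃ Ψ : W →ₗ[K] Module.End K L, ∀ a, F a = Ψ a) (u : Module.End K L) :
    ∃ Ψ : W →ₗ[K] Module.End K L, ∀ a, u ∘ₗ F a = Ψ a := by
  obtain ⟨Ψ, h⟩ := h
  exact ⟨LinearMap.mulLeft K u ∘ₗ Ψ, fun a => by rw [h]; rfl⟩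

variable (A : NHomLeibniz K L m)

/-- `ᾱ : 𝒟ₙ₋₁(L) → 𝒟ₙ₋₁(L)`, `x₁ ⊗ ⋯ ⊗ xₙ₋₁ ↦ α x₁ ⊗ ⋯ ⊗ α xₙ₋₁`. -/
def αbar : Module.End K (D K L m) := PiTensorProduct.map (fun _ => A.α)

/-- `ad X z = [z, X] = [z, X¹, …, Xⁿ⁻¹]`. -/
def ad : D K L m →ₗ[K] Module.End K L :=
  ((PiTensorProduct.lift (R := K) (s := fun _ : Fin m => L) (E := L)).toLinearMap ∘ₗ
    A.bracket.curryLeft).flip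

theorem ad_tprod (x : Fin m → L) (z : L) :
    A.ad (PiTensorProduct.tprod K x) z = A.bracket (Fin.cons z x : Fin (m + 1) → L) := by
  simp [ad]

/-- The bracket of the Hom-Leibniz algebra `𝒟ₙ₋₁(L)`:
`[X, Y] = ∑ᵢ α X¹ ⊗ ⋯ ⊗ [Xⁱ, Y] ⊗ ⋯ ⊗ α Xⁿ⁻¹`. -/
def brD (X Y : D K L m) : D K L m := insertion A.α (A.ad Y) X

/-! ### Cochains -/

/-- The linear maps `f : L ⊗ 𝒟ₙ₋₁(L)^{⊗ p} → L` such that `α ∘ f = f ∘ (α ⊗ ᾱ^{⊗ p})`. -/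
def cochains (p : ℕ) : Submodule K (PreCochain K L m p) where
  carrier := {f | ∀ X : Fin p → D K L m, A.α ∘ₗ f X = f (fun i => A.αbar (X i)) ∘ₗ A.α}
  add_mem' := fun {f g} hf hg X => by
    rw [add_apply, add_apply, LinearMap.comp_add, hf, hg,
      LinearMap.add_comp]
  zero_mem' := fun X => by simp
  smul_mem' := fun c f hf X => by
    rw [smul_apply, smul_apply, LinearMap.comp_smul, hf,
      LinearMap.smul_comp]

/-- The space of cochains `Γᵖ(L) = C^{p+1}(L, L)`. -/
def Γ (p : ℕ) : Type _ := A.cochains p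

instance (p : ℕ) : AddCommGroup (A.Γ p) := inferInstanceAs (AddCommGroup (A.cochains p))

instance (p : ℕ) : Module K (A.Γ p) := by
  exact (inferInstance : Module K (A.cochains p))

theorem α_comp_ad (X : D K L m) : A.α ∘ₗ A.ad X = A.ad (A.αbar X) ∘ₗ A.α := by
  induction X using PiTensorProduct.induction_on with
  | smul_tprod r x =>
    ext z
    simp only [map_smul, LinearMap.comp_apply, LinearMap.smul_apply, αbar,
      PiTensorProduct.map_tprod, ad_tprod, map_bracket]
    congr 2
    funext i
    refine Fin.cases ?_ (fun i => ?_) i <;> simp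
  | add x y hx hy => rw [map_add, map_add, map_add, LinearMap.comp_add, hx, hy, LinearMap.add_comp]

theorem αbar_insertion (φ ψ : Module.End K L) (h : A.α ∘ₗ φ = ψ ∘ₗ A.α) (q : ℕ) (X : D K L m) :
    A.αbar (insertion (A.α ^ q) φ X) = insertion (A.α ^ q) ψ (A.αbar X) := by
  induction X using PiTensorProduct.induction_on with
  | smul_tprod r x =>
    simp only [map_smul, insertion_tprod, αbar, PiTensorProduct.map_tprod, map_sum]
    congr 1
    refine Finset.sum_congr rfl fun s _ => congrArg _ (funext fun t => ?_)
    by_cases hts : t = s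
    · subst hts
      simpa using LinearMap.congr_fun h (x t)
    · simp only [Function.update_of_ne hts]
      rw [← Module.End.mul_apply, ← Module.End.mul_apply, ← pow_succ', ← pow_succ]
  | add x y hx hy => simp only [map_add, hx, hy]

theorem αbar_pow_comm (q : ℕ) (X : D K L m) :
    A.αbar ((A.αbar ^ q) X) = (A.αbar ^ q) (A.αbar X) := by
  rw [← Module.End.mul_apply, ← Module.End.mul_apply, ← pow_succ', ← pow_succ]

theorem α_pow_comm (q : ℕ) : A.α ∘ₗ (A.α ^ q) = (A.α ^ q) ∘ₗ A.α := by
  change A.α * A.α ^ q = A.α ^ q * A.α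
  rw [← pow_succ', ← pow_succ]

/-! ### The coboundary -/

/-- The first term of the coboundary, for `i < j`:
`f (α z, ᾱ X₁, …, ᾱ Xᵢ₋₁, [Xᵢ, Xⱼ], ᾱ Xᵢ₊₁, …, X̂ⱼ, …, ᾱ X_{p+1})`. -/
def dTerm₁ {p : ℕ} (f : PreCochain K L m p) (i j : Fin (p + 1)) (X : Fin (p + 1) → D K L m) :
    Module.End K L :=
  f (fun l => if j.succAbove l = i then A.brD (X i) (X j) else A.αbar (X (j.succAbove l))) ∘ₗ A.α

/-- The second term of the coboundary: `f ([z, Xᵢ], ᾱ X₁, …, X̂ᵢ, …, ᾱ X_{p+1})`. -/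
def dTerm₂ {p : ℕ} (f : PreCochain K L m p) (i : Fin (p + 1)) (X : Fin (p + 1) → D K L m) :
    Module.End K L :=
  f (fun l => A.αbar (X (i.succAbove l))) ∘ₗ A.ad (X i)

/-- The third term of the coboundary: `[f (z, X₁, …, X̂ᵢ, …, X_{p+1}), ᾱᵖ Xᵢ]`. -/
def dTerm₃ {p : ℕ} (f : PreCochain K L m p) (i : Fin (p + 1)) (X : Fin (p + 1) → D K L m) :
    Module.End K L :=
  A.ad ((A.αbar ^ p) (X i)) ∘ₗ f (fun l => X (i.succAbove l))

/-- The fourth term of the coboundary: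
`∑ₛ [αᵖ z, αᵖ X₁¹, …, αᵖ X₁ˢ⁻¹, f (X₁ˢ, X₂, …, X_{p+1}), αᵖ X₁ˢ⁺¹, …, αᵖ X₁ⁿ⁻¹]`. -/
def dTerm₄ {p : ℕ} (f : PreCochain K L m p) (X : Fin (p + 1) → D K L m) : Module.End K L :=
  A.ad (insertion (A.α ^ p) (f (fun l => X l.succ)) (X 0)) ∘ₗ (A.α ^ p)

/-- The coboundary formula, for `f ∈ Γᵖ(L) = C^{p+1}(L, L)`. The index `i : Fin (p + 1)` stands for
the index `i + 1` in `1, …, p + 1`. -/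
def dFun {p : ℕ} (f : PreCochain K L m p) (X : Fin (p + 1) → D K L m) : Module.End K L :=
  (∑ j : Fin (p + 1), ∑ i ∈ Finset.univ.filter (fun i => i < j),
      (-1 : ℤ) ^ ((j : ℕ) + 1) • A.dTerm₁ f i j X)
    + (∑ i : Fin (p + 1), (-1 : ℤ) ^ ((i : ℕ) + 1) • A.dTerm₂ f i X)
    + (∑ i : Fin (p + 1), (-1 : ℤ) ^ (((i : ℕ) + 1) + 1) • A.dTerm₃ f i X)
    + A.dTerm₄ f X

theorem isML_dTerm₁ {p : ℕ} (f : PreCochain K L m p) (i j : Fin (p + 1)) (hij : i < j) :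
    IsML (K := K) (A.dTerm₁ f i j) := fun X t => by
  refine exists_mul_right ?_ A.α
  by_cases ht : t = j
  · subst ht
    obtain ⟨l₀, hl₀⟩ := Fin.exists_succAbove_eq hij.ne
    refine slot_linear f _ l₀ (((insertion A.α) ∘ₗ A.ad).flip (X i)) (fun a => ?_)
      (fun a l hl => ?_)
    · simp [hl₀, brD, Function.update_of_ne hij.ne]
    · have : t.succAbove l ≠ i := fun h => hl (Fin.succAbove_right_injective (h.trans hl₀.symm))
      simp [this]
  · obtain ⟨l₀, hl₀⟩ := Fin.exists_succAbove_eq ht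
    by_cases hti : t = i
    · subst hti
      refine slot_linear f _ l₀ (insertion A.α (A.ad (X j))) (fun a => ?_) (fun a l hl => ?_)
      · simp [hl₀, brD, Function.update_of_ne hij.ne']
      · have : j.succAbove l ≠ t := fun h => hl (Fin.succAbove_right_injective (h.trans hl₀.symm))
        simp [this]
    · refine slot_linear f _ l₀ A.αbar (fun a => ?_) (fun a l hl => ?_)
      · simp [hl₀, hti]
      · have : j.succAbove l ≠ t := fun h => hl (Fin.succAbove_right_injective (h.trans hl₀.symm))
        simp [Function.update_of_ne this, Function.update_of_ne (Ne.symm ht),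
          Function.update_of_ne (Ne.symm hti)]

theorem isML_dTerm₂ {p : ℕ} (f : PreCochain K L m p) (i : Fin (p + 1)) :
    IsML (K := K) (A.dTerm₂ f i) := fun X t => by
  by_cases ht : t = i
  · subst ht
    obtain ⟨Ψ, h⟩ := exists_mul_left (F := fun a => A.ad a) ⟨A.ad, fun _ => rfl⟩
      (f (fun l => A.αbar (X (t.succAbove l))))
    refine ⟨Ψ, fun a => ?_⟩
    rw [← h]
    simp [dTerm₂]
  · obtain ⟨l₀, hl₀⟩ := Fin.exists_succAbove_eq ht
    simp only [dTerm₂, Function.update_of_ne (Ne.symm ht)]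
    refine exists_mul_right (slot_linear f _ l₀ A.αbar (fun a => ?_) (fun a l hl => ?_)) _
    · simp [hl₀]
    · have : i.succAbove l ≠ t := fun h => hl (Fin.succAbove_right_injective (h.trans hl₀.symm))
      simp [Function.update_of_ne this]

theorem isML_dTerm₃ {p : ℕ} (f : PreCochain K L m p) (i : Fin (p + 1)) :
    IsML (K := K) (A.dTerm₃ f i) := fun X t => by
  by_cases ht : t = i
  · subst ht
    obtain ⟨Ψ, h⟩ := exists_mul_right (F := fun a => A.ad ((A.αbar ^ p) a))
      ⟨A.ad ∘ₗ (A.αbar ^ p), fun _ => rfl⟩ (f (fun l => X (t.succAbove l)))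
    refine ⟨Ψ, fun a => ?_⟩
    rw [← h]
    simp [dTerm₃]
  · obtain ⟨l₀, hl₀⟩ := Fin.exists_succAbove_eq ht
    simp only [dTerm₃, Function.update_of_ne (Ne.symm ht)]
    refine exists_mul_left (slot_linear f _ l₀ LinearMap.id (fun a => ?_) (fun a l hl => ?_)) _
    · simp [hl₀]
    · have : i.succAbove l ≠ t := fun h => hl (Fin.succAbove_right_injective (h.trans hl₀.symm))
      simp [Function.update_of_ne this]

theorem isML_dTerm₄ {p : ℕ} (f : PreCochain K L m p) :
    IsML (K := K) (A.dTerm₄ f) := fun X t => by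
  refine exists_mul_right ?_ _
  refine Fin.cases ?_ (fun t => ?_) t
  · refine ⟨A.ad ∘ₗ insertion (A.α ^ p) (f (fun l => X l.succ)), fun a => ?_⟩
    simp
  · obtain ⟨Ψ, h⟩ := slot_linear f (fun a l => Function.update X t.succ a l.succ) t LinearMap.id
      (fun a => by simp) (fun a l hl => by
        have : l.succ ≠ t.succ := fun h => hl (Fin.succ_injective _ h)
        simp [Function.update_of_ne this])
    refine ⟨A.ad ∘ₗ ((insertion (A.α ^ p)).flip (X 0)) ∘ₗ Ψ, fun a => ?_⟩
    simp [h, Function.update_of_ne (Fin.succ_ne_zero t).symm]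

theorem isML_dFun {p : ℕ} (f : PreCochain K L m p) : IsML (K := K) (A.dFun f) :=
  (((IsML.sum _ fun j _ => IsML.sum _ fun i hi =>
      (A.isML_dTerm₁ f i j (Finset.mem_filter.mp hi).2).zsmul _).add
    (IsML.sum _ fun i _ => (A.isML_dTerm₂ f i).zsmul _)).add
    (IsML.sum _ fun i _ => (A.isML_dTerm₃ f i).zsmul _)).add (A.isML_dTerm₄ f)

theorem equi_dFun {p : ℕ} {f : PreCochain K L m p} (hf : f ∈ A.cochains p)
    (X : Fin (p + 1) → D K L m) :
    A.α ∘ₗ A.dFun f X = A.dFun f (fun i => A.αbar (X i)) ∘ₗ A.α := by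
  have h₁ : ∀ i j, A.α ∘ₗ A.dTerm₁ f i j X = A.dTerm₁ f i j (fun i => A.αbar (X i)) ∘ₗ A.α := by
    intro i j
    simp only [dTerm₁]
    rw [← LinearMap.comp_assoc, hf]
    congr 2
    congr 1
    funext l
    split_ifs
    · have := A.αbar_insertion _ _ (A.α_comp_ad (X j)) 1 (X i)
      rw [pow_one] at this
      exact this
    · rfl
  have h₂ : ∀ i, A.α ∘ₗ A.dTerm₂ f i X = A.dTerm₂ f i (fun i => A.αbar (X i)) ∘ₗ A.α := by
    intro i
    simp only [dTerm₂]
    rw [← LinearMap.comp_assoc, hf, LinearMap.comp_assoc, α_comp_ad, LinearMap.comp_assoc]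
  have h₃ : ∀ i, A.α ∘ₗ A.dTerm₃ f i X = A.dTerm₃ f i (fun i => A.αbar (X i)) ∘ₗ A.α := by
    intro i
    simp only [dTerm₃]
    rw [← LinearMap.comp_assoc, α_comp_ad, LinearMap.comp_assoc, hf, LinearMap.comp_assoc,
      αbar_pow_comm]
  have h₄ : A.α ∘ₗ A.dTerm₄ f X = A.dTerm₄ f (fun i => A.αbar (X i)) ∘ₗ A.α := by
    simp only [dTerm₄]
    rw [← LinearMap.comp_assoc, α_comp_ad, LinearMap.comp_assoc, α_pow_comm,
      A.αbar_insertion _ _ (hf _), LinearMap.comp_assoc]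
  simp only [dFun]
  change A.α * _ = _ * A.α
  change ∀ i j, A.α * _ = _ * A.α at h₁
  change ∀ i, A.α * _ = _ * A.α at h₂ h₃
  change A.α * _ = _ * A.α at h₄
  simp only [mul_add, add_mul, Finset.mul_sum, Finset.sum_mul, mul_smul_comm, smul_mul_assoc,
    h₁, h₂, h₃, h₄]

/-- The coboundary `δ : Γᵖ(L) = C^{p+1}(L, L) → C^{p+2}(L, L) = Γ^{p+1}(L)`. -/
def δ (p : ℕ) : A.Γ p →ₗ[K] A.Γ (p + 1) where
  toFun f := Subtype.mk (mkML (A.dFun f.1) (A.isML_dFun f.1)) (A.equi_dFun f.2)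
  map_add' f g := by
    refine Subtype.ext (MultilinearMap.ext fun X => ?_)
    change A.dFun (f.1 + g.1) X = A.dFun f.1 X + A.dFun g.1 X
    simp only [dFun, dTerm₁, dTerm₂, dTerm₃, dTerm₄, add_apply, LinearMap.add_comp,
      LinearMap.comp_add, map_add, LinearMap.add_apply, smul_add, Finset.sum_add_distrib]
    abel
  map_smul' c f := by
    refine Subtype.ext (MultilinearMap.ext fun X => ?_)
    change A.dFun (c • f.1) X = c • A.dFun f.1 X
    simp only [dFun, dTerm₁, dTerm₂, dTerm₃, dTerm₄, smul_apply,
      LinearMap.smul_comp, LinearMap.comp_smul, map_smul, LinearMap.smul_apply, smul_add,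
      Finset.smul_sum, smul_comm c (_ : ℤ)]

/-! ### The bracket on cochains -/

/-- The `(q, N - q - k)`-shuffles of `{k+1, …, N}`, as permutations of `{1, …, N}` fixing
`1, …, k`; here `i : Fin N` stands for `i + 1`. -/
def shuffles (k q N : ℕ) : Finset (Equiv.Perm (Fin N)) :=
  Finset.univ.filter fun σ =>
    (∀ i : Fin N, (i : ℕ) < k → σ i = i) ∧
    (∀ i j : Fin N, k ≤ (i : ℕ) → i < j → (j : ℕ) < k + q → σ i < σ j) ∧
    (∀ i j : Fin N, k + q ≤ (i : ℕ) → i < j → σ i < σ j)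

/-- `f ∘₀ g` for the identity shuffle, `N = p + q`:
`f (g (z, X₁, …, X_q), ᾱ^q X_{q+1}, …, ᾱ^q X_{q+p})`. -/
def circZero {p q N : ℕ} (h : p + q = N) (f : PreCochain K L m p) (g : PreCochain K L m q)
    (X : Fin N → D K L m) : Module.End K L :=
  f (fun j => (A.αbar ^ q) (X ⟨q + j, by omega⟩)) ∘ₗ g (fun j => X ⟨j, by omega⟩)

/-- `f ∘ₖ g` for the identity shuffle, `k = k' + 1 ∈ {1, …, p}`, `N = p + q`:
`∑ₛ f (α^q z, ᾱ^q X₁, …, ᾱ^q Xₖ₋₁, (α^q Xₖ¹, …, g (Xₖˢ, Xₖ₊₁, …, X_{k+q}), …, α^q Xₖⁿ⁻¹),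
ᾱ^q X_{k+q+1}, …, ᾱ^q X_{p+q})`. -/
def circSucc {p q N : ℕ} (h : p + q = N) (f : PreCochain K L m p) (g : PreCochain K L m q)
    (k' : Fin p) (X : Fin N → D K L m) : Module.End K L :=
  f (fun j =>
      if j < k' then (A.αbar ^ q) (X ⟨j, by omega⟩)
      else if j = k' then
        insertion (A.α ^ q) (g (fun l => X ⟨(k' : ℕ) + 1 + l, by omega⟩)) (X ⟨k', by omega⟩)
      else (A.αbar ^ q) (X ⟨q + j, by omega⟩)) ∘ₗ (A.α ^ q)

/-- `f ∘ₖ g` for the identity shuffle, `0 ≤ k ≤ p`. -/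
def circBase {p q N : ℕ} (h : p + q = N) (f : PreCochain K L m p) (g : PreCochain K L m q)
    (k : Fin (p + 1)) : (Fin N → D K L m) → Module.End K L :=
  Fin.cases (A.circZero h f g) (fun k' => A.circSucc h f g k') k

/-- `f ∘ₖ^σ g` for `0 ≤ k ≤ p`. A shuffle `σ` fixes `1, …, k`, so that `f ∘ₖ^σ g` arises from the
identity shuffle by replacing every `Xᵢ` by `X_{σ(i)}`. -/
def circ {p q N : ℕ} (h : p + q = N) (f : PreCochain K L m p) (g : PreCochain K L m q)
    (k : Fin (p + 1)) (σ : Equiv.Perm (Fin N)) (X : Fin N → D K L m) : Module.End K L :=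
  A.circBase h f g k (fun i => X (σ i))

/-- `i_f(g) = ∑ₖ (-1)^{kq} ∑_{σ ∈ Sh(q, p-k)} ε(σ) f ∘ₖ^σ g`. -/
def iFun {p q N : ℕ} (h : p + q = N) (f : PreCochain K L m p) (g : PreCochain K L m q)
    (X : Fin N → D K L m) : Module.End K L :=
  ∑ k : Fin (p + 1), (-1 : ℤ) ^ ((k : ℕ) * q) •
    ∑ σ ∈ shuffles k q N, (Equiv.Perm.sign σ : ℤ) • A.circ h f g k σ X

theorem isML_circZero {p q N : ℕ} (h : p + q = N) (f : PreCochain K L m p)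
    (g : PreCochain K L m q) : IsML (K := K) (A.circZero h f g) := fun X t => by
  by_cases ht : (t : ℕ) < q
  · have hne : ∀ (a : D K L m) (j : Fin p),
        Function.update X t a ⟨q + j, by omega⟩ = X ⟨q + j, by omega⟩ := fun a j =>
      Function.update_of_ne (by rw [Ne, Fin.ext_iff]; first | omega | (dsimp only; omega)) _ _
    simp only [circZero, hne]
    refine exists_mul_left (slot_linear g _ ⟨t, ht⟩ LinearMap.id (fun a => ?_)
      (fun a l hl => ?_)) _
    · simp
    · have : (⟨l, by omega⟩ : Fin N) ≠ t := fun e => hl (by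
        have := congrArg Fin.val e
        exact Fin.ext this)
      simp [Function.update_of_ne this]
  · have hne : ∀ (a : D K L m) (j : Fin q),
        Function.update X t a ⟨j, by omega⟩ = X ⟨j, by omega⟩ := fun a j =>
      Function.update_of_ne (by rw [Ne, Fin.ext_iff]; first | omega | (dsimp only; omega)) _ _
    simp only [circZero, hne]
    refine exists_mul_right (slot_linear f _ ⟨t - q, by omega⟩ (A.αbar ^ q) (fun a => ?_)
      (fun a l hl => ?_)) _
    · have : (⟨q + (t - q), by omega⟩ : Fin N) = t := by ext; dsimp only; omega
      simp [this]
    · have : (⟨q + l, by omega⟩ : Fin N) ≠ t := fun e => hl (by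
        have := congrArg Fin.val e
        ext; simp only [] at this ⊢; omega)
      simp [Function.update_of_ne this]

theorem isML_circSucc {p q N : ℕ} (h : p + q = N) (f : PreCochain K L m p)
    (g : PreCochain K L m q) (k' : Fin p) : IsML (K := K) (A.circSucc h f g k') := fun X t => by
  refine exists_mul_right ?_ _
  have key : ∀ (n : ℕ) (hn : n < N) (a : D K L m), n ≠ t →
      Function.update X t a ⟨n, hn⟩ = X ⟨n, hn⟩ := fun n hn a hne =>
    Function.update_of_ne (by rw [Ne, Fin.ext_iff]; exact hne) _ _
  have key' : ∀ (n : ℕ) (hn : n < N) (a : D K L m), n = t →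
      Function.update X t a ⟨n, hn⟩ = a := fun n hn a hne => by
    have : (⟨n, hn⟩ : Fin N) = t := Fin.ext hne
    rw [this, Function.update_self]
  rcases lt_trichotomy (t : ℕ) (k' : ℕ) with h1 | h1 | h1
  · refine slot_linear f _ ⟨t, by omega⟩ (A.αbar ^ q) (fun a => ?_) (fun a j hj => ?_)
    · simp [Fin.lt_def, h1]
    · have hj' : (j : ℕ) ≠ t := fun e => hj (Fin.ext e)
      split_ifs with c1 c2
      · rw [key _ _ _ hj', key _ _ _ hj']
      · rw [key _ _ _ (by omega), key _ _ _ (by omega)]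
        have hl : ∀ a : D K L m, (fun l : Fin q => Function.update X t a
            ⟨(k' : ℕ) + 1 + l, by omega⟩) = fun l : Fin q => X ⟨(k' : ℕ) + 1 + l, by omega⟩ :=
          fun a => funext fun l => key _ _ _ (by omega)
        rw [hl, hl]
      · have : (k' : ℕ) < j := lt_of_le_of_ne (not_lt.mp c1) (fun e => c2 (Fin.ext e.symm))
        rw [key _ _ _ (by omega), key _ _ _ (by omega)]
  · refine slot_linear f _ k' (insertion (A.α ^ q)
      (g (fun l => X ⟨(k' : ℕ) + 1 + l, by omega⟩))) (fun a => ?_) (fun a j hj => ?_)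
    · simp only [lt_irrefl, if_false, if_true]
      rw [key' _ _ _ h1.symm]
      have hl : ∀ a : D K L m, (fun l : Fin q => Function.update X t a
          ⟨(k' : ℕ) + 1 + l, by omega⟩) = fun l : Fin q => X ⟨(k' : ℕ) + 1 + l, by omega⟩ :=
        fun a => funext fun l => key _ _ _ (by omega)
      rw [hl]
    · have hj' : (j : ℕ) ≠ k' := fun e => hj (Fin.ext e)
      split_ifs with c1
      · rw [key _ _ _ (by omega), key _ _ _ (by omega)]
      · have : (k' : ℕ) < j := lt_of_le_of_ne (not_lt.mp c1) (Ne.symm hj')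
        rw [key _ _ _ (by omega), key _ _ _ (by omega)]
  · by_cases h2 : (t : ℕ) < k' + 1 + q
    · obtain ⟨Ψ, hΨ⟩ := slot_linear g
        (fun a l => Function.update X t a ⟨(k' : ℕ) + 1 + l, by omega⟩)
        ⟨t - (k' + 1), by omega⟩ LinearMap.id
        (fun a => key' _ _ _ (by first | omega | (dsimp only; omega)))
        (fun a l hl => by
          have : (l : ℕ) ≠ t - (k' + 1) := fun e => hl (Fin.ext e)
          rw [key _ _ _ (by omega), key _ _ _ (by omega)])
      refine slot_linear f _ k' (((insertion (A.α ^ q)).flip (X ⟨k', by omega⟩)) ∘ₗ Ψ)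
        (fun a => ?_) (fun a j hj => ?_)
      · simp only [lt_irrefl, if_false, if_true]
        rw [key _ _ _ (by omega), hΨ]
        rfl
      · have hj' : (j : ℕ) ≠ k' := fun e => hj (Fin.ext e)
        split_ifs with c1
        · have : (j : ℕ) < k' := c1
          rw [key _ _ _ (by omega), key _ _ _ (by omega)]
        · have : (k' : ℕ) < j := lt_of_le_of_ne (not_lt.mp c1) (Ne.symm hj')
          rw [key _ _ _ (by omega), key _ _ _ (by omega)]
    · refine slot_linear f _ ⟨t - q, by omega⟩ (A.αbar ^ q) (fun a => ?_) (fun a j hj => ?_)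
      · rw [if_neg (by rw [Fin.lt_def]; first | omega | (dsimp only; omega)),
          if_neg (by rw [Fin.ext_iff]; first | omega | (dsimp only; omega)), key' _ _ _ (by first | omega | (dsimp only; omega))]
      · have hj' : (j : ℕ) ≠ t - q := fun e => hj (Fin.ext e)
        split_ifs with c1 c2
        · have : (j : ℕ) < k' := c1
          rw [key _ _ _ (by omega), key _ _ _ (by omega)]
        · rw [key _ _ _ (by omega), key _ _ _ (by omega)]
          have hl : ∀ a : D K L m, (fun l : Fin q => Function.update X t a
              ⟨(k' : ℕ) + 1 + l, by omega⟩) = fun l : Fin q => X ⟨(k' : ℕ) + 1 + l, by omega⟩ :=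
            fun a => funext fun l => key _ _ _ (by omega)
          rw [hl, hl]
        · rw [key _ _ _ (by omega), key _ _ _ (by omega)]

theorem isML_circ {p q N : ℕ} (h : p + q = N) (f : PreCochain K L m p) (g : PreCochain K L m q)
    (k : Fin (p + 1)) (σ : Equiv.Perm (Fin N)) : IsML (K := K) (A.circ h f g k σ) := fun X t => by
  have hbase : IsML (K := K) (A.circBase h f g k) := by
    refine Fin.cases ?_ (fun k' => ?_) k
    · exact A.isML_circZero h f g
    · exact A.isML_circSucc h f g k'
  obtain ⟨Ψ, hΨ⟩ := hbase (fun i => X (σ i)) (σ.symm t)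
  refine ⟨Ψ, fun a => ?_⟩
  rw [← hΨ, circ]
  congr 1
  funext i
  by_cases hi : i = σ.symm t
  · subst hi; simp
  · have : σ i ≠ t := fun e => hi (by rw [← e]; simp)
    rw [Function.update_of_ne this, Function.update_of_ne hi]

theorem isML_iFun {p q N : ℕ} (h : p + q = N) (f : PreCochain K L m p) (g : PreCochain K L m q) :
    IsML (K := K) (A.iFun h f g) :=
  IsML.sum _ fun k _ => (IsML.sum _ fun σ _ => (A.isML_circ h f g k σ).zsmul _).zsmul _

theorem equi_circBase {p q N : ℕ} (h : p + q = N) {f : PreCochain K L m p}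
    {g : PreCochain K L m q} (hf : f ∈ A.cochains p) (hg : g ∈ A.cochains q) (k : Fin (p + 1))
    (X : Fin N → D K L m) :
    A.α ∘ₗ A.circBase h f g k X = A.circBase h f g k (fun i => A.αbar (X i)) ∘ₗ A.α := by
  refine Fin.cases ?_ (fun k' => ?_) k
  · change A.α ∘ₗ A.circZero h f g X = A.circZero h f g (fun i => A.αbar (X i)) ∘ₗ A.α
    simp only [circZero]
    rw [← LinearMap.comp_assoc, hf, LinearMap.comp_assoc, hg, LinearMap.comp_assoc]
    simp only [αbar_pow_comm]
  · change A.α ∘ₗ A.circSucc h f g k' X = A.circSucc h f g k' (fun i => A.αbar (X i)) ∘ₗ A.α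
    simp only [circSucc]
    rw [← LinearMap.comp_assoc, hf, LinearMap.comp_assoc, α_pow_comm, LinearMap.comp_assoc]
    congr 2
    funext j
    split_ifs
    · rw [αbar_pow_comm]
    · rw [A.αbar_insertion _ _ (hg _)]
    · rw [αbar_pow_comm]

theorem equi_iFun {p q N : ℕ} (h : p + q = N) {f : PreCochain K L m p} {g : PreCochain K L m q}
    (hf : f ∈ A.cochains p) (hg : g ∈ A.cochains q) (X : Fin N → D K L m) :
    A.α ∘ₗ A.iFun h f g X = A.iFun h f g (fun i => A.αbar (X i)) ∘ₗ A.α := by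
  have hc : ∀ k (σ : Equiv.Perm (Fin N)), A.α * A.circ h f g k σ X =
      A.circ h f g k σ (fun i => A.αbar (X i)) * A.α :=
    fun k σ => A.equi_circBase h hf hg k (fun i => X (σ i))
  simp only [iFun]
  change A.α * _ = _ * A.α
  simp only [Finset.mul_sum, Finset.sum_mul, mul_smul_comm, smul_mul_assoc, hc]

/-- The bracket `[f, g]_𝒩 = i_f(g) + (-1)^{pq+1} i_g(f) ∈ Γ^N(L)`, `N = p + q`, of `f ∈ Γᵖ(L)` and
`g ∈ Γ^q(L)`. -/
def brN {p q N : ℕ} (h : p + q = N) (f : A.Γ p) (g : A.Γ q) : A.Γ N :=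
  Subtype.mk (mkML (fun X => A.iFun h f.1 g.1 X +
      (-1 : ℤ) ^ (p * q + 1) • A.iFun ((Nat.add_comm q p).trans h) g.1 f.1 X)
    ((A.isML_iFun h f.1 g.1).add ((A.isML_iFun _ g.1 f.1).zsmul _))) fun X => by
    have h₁ := A.equi_iFun h f.2 g.2 X
    have h₂ := A.equi_iFun ((Nat.add_comm q p).trans h) g.2 f.2 X
    change A.α * _ = _ * A.α at h₁ h₂
    change A.α * (_ + _) = (_ + _) * A.α
    simp only [mul_add, add_mul, mul_smul_comm, smul_mul_assoc, h₁, h₂]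

/-! ### Cohomology -/

/-- The cocycles `𝒵^{p+1}(L, L) ⊆ C^{p+1}(L, L) = Γᵖ(L)`. -/
def Z (p : ℕ) : Submodule K (A.Γ p) := LinearMap.ker (A.δ p)

/-- The coboundaries `ℬ^{p+1}(L, L) ⊆ C^{p+1}(L, L) = Γᵖ(L)`; since `C⁰(L, L) = 0`, they vanish
for `p = 0`. -/
def B : (p : ℕ) → Submodule K (A.Γ p)
  | 0 => ⊥
  | p + 1 => LinearMap.range (A.δ p)

/-- The cohomology `H^{p+1}(L, L) = 𝒵^{p+1}(L, L) / ℬ^{p+1}(L, L)`. -/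
abbrev H (p : ℕ) : Type _ := A.Z p ⧸ (A.B p).submoduleOf (A.Z p)

/-- The cohomology class of a cocycle. -/
def cls {p : ℕ} (f : A.Γ p) (hf : f ∈ A.Z p) : A.H p :=
  Submodule.Quotient.mk ⟨f, hf⟩

end NHomLeibniz

/-- A family of operations `Vᵖ × V^q → V^N`, `N = p + q`, is a graded Lie bracket (of degree `0`)
on the graded vector space `V`. -/
structure IsGradedLieBracket (K : Type*) [Field K] (V : ℕ → Type*) [∀ p, AddCommGroup (V p)]
    [∀ p, Module K (V p)] (br : ∀ {p q N : ℕ}, p + q = N → V p → V q → V N) : Prop where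
  add_left : ∀ {p q N : ℕ} (h : p + q = N) (f f' : V p) (g : V q),
    br h (f + f') g = br h f g + br h f' g
  smul_left : ∀ {p q N : ℕ} (h : p + q = N) (c : K) (f : V p) (g : V q),
    br h (c • f) g = c • br h f g
  add_right : ∀ {p q N : ℕ} (h : p + q = N) (f : V p) (g g' : V q),
    br h f (g + g') = br h f g + br h f g'
  smul_right : ∀ {p q N : ℕ} (h : p + q = N) (c : K) (f : V p) (g : V q),
    br h f (c • g) = c • br h f g
  /-- `[f, g] = -(-1)^{pq} [g, f]` -/
  antisymm : ∀ {p q N : ℕ} (h : p + q = N) (h' : q + p = N) (f : V p) (g : V q),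
    br h f g = -((-1 : ℤ) ^ (p * q) • br h' g f)
  /-- `(-1)^{pr} [[f, g], h] + (-1)^{qp} [[g, h], f] + (-1)^{rq} [[h, f], g] = 0` -/
  jacobi : ∀ {p q r N : ℕ} (h₁ : (p + q) + r = N) (h₂ : (q + r) + p = N) (h₃ : (r + p) + q = N)
      (f : V p) (g : V q) (h : V r),
    (-1 : ℤ) ^ (p * r) • br h₁ (br rfl f g) h
      + (-1 : ℤ) ^ (q * p) • br h₂ (br rfl g h) f
      + (-1 : ℤ) ^ (r * q) • br h₃ (br rfl h f) g = 0

end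

/-!
The bracket `[f, g] = i_f(g) - (-1)^{pq} i_g(f)` is the graded commutator bracket of coderivations,
read off on cochains. Let the letters of a word in `𝒟 = L^{⊗(n-1)}` be odd, and equip the words
with the unshuffle coproduct (`unshuffle`), which is coassociative and graded cocommutative
(`unshuffle_coassoc`, `unshuffle_comm`). A cochain `g` of degree `q` acts on words by an operator
`R_g` (`wordIns`): one letter `X` is replaced by
`∑ₛ α^q X¹ ⊗ ⋯ ⊗ g(Xˢ, …) ⊗ ⋯ ⊗ α^q Xⁿ⁻¹`, the arguments of `g` are taken out of the letters
to the right of `X`, and the remaining letters are twisted by `ᾱ^q`. It also acts on pairs `z ⊗ w`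
of `z ∈ L` and a word `w`, by `E_g(z ⊗ w) = ∑ ± g(z, w') ⊗ ᾱ^q w'' + α^q z ⊗ R_g(w)` (`pointedIns`),
and `i_f(g) = f ∘ E_g` (`iFun_eq_ins`).

The operator `R_g` is a twisted coderivation of the unshuffle coproduct (`coder_unshuffle`).
From this, `[E_f, E_g] = E_{[f, g]}` and `[R_f, R_g] = R_{[f, g]}` follow together by induction on
the length of the word, since `R_g` on a nonempty word `X w` is, up to sign, `E_g` on `X ⊗ w` with
`L` replaced by `𝒟` (`pointedIns_comm`, `wordIns_comm`). To treat `L` and `𝒟` alike, the entry on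
the left may lie in any module with a twisted representation of `End L`, which `𝒟` carries
because `φ ↦ ∑ₛ β ⊗ ⋯ ⊗ φ ⊗ ⋯ ⊗ β` turns twisted commutators into twisted commutators
(`isTwistedRep_insertion`). Consequently `h ∘ E_{[f, g]} = (h ∘ E_f) ∘ E_g ∓ (h ∘ E_g) ∘ E_f`
(`ins_wordBr`), and the graded Jacobi identity is a cancellation of twelve terms (`brN_jacobi`).

The multiplication `π(z, X) = [z, X]` is a cochain of degree `1`. Expanding the formulas gives
`δ f = -[f, π]` (`δ_eq_neg_brN`), and the Hom-Leibniz identity says `i_π(π) = 0`. Hence the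
derivation rule and `δ ∘ δ = 0` are instances of the Jacobi identity, the latter after division
by `2`. The statements on cohomology are formal consequences.

Sums over words are written in continuation style: `unshuffle w F` and `coder q t G w F` are the
values of a function `F` on the coproduct of `w` and on the image of `w` under a coderivation, so
that no tensor algebra is needed.
-/

noncomputable section

namespace NHomLeibniz

/-! ### Words and unshuffles -/

section Words

variable {W V V' : Type*} [AddCommGroup V] [AddCommGroup V']

/-- The sum of `± F a b` over all ways to split the word `w` into two complementary subwords `a`
and `b`, with the sign of the corresponding unshuffle: the value of `F` on the unshuffle coproduct
of `w`, all letters being odd. -/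
def unshuffle : List W → (List W → List W → V) → V
  | [], F => F [] []
  | x :: w, F => unshuffle w (fun a b => F (x :: a) b) +
      unshuffle w (fun a b => (-1 : ℤ) ^ a.length • F a (x :: b))

theorem unshuffle_congr {w : List W} {F F' : List W → List W → V}
    (h : ∀ a b, a.length + b.length = w.length → F a b = F' a b) :
    unshuffle w F = unshuffle w F' := by
  induction w generalizing F F' with
  | nil => exact h _ _ rfl
  | cons x w ih =>
    simp only [unshuffle]
    congr 1
    · exact ih fun a b hab => h _ _ (by simp; omega)
    · exact ih fun a b hab => by rw [h _ _ (by simp; omega)]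

theorem map_unshuffle (φ : V →+ V') (w : List W) (F : List W → List W → V) :
    φ (unshuffle w F) = unshuffle w fun a b => φ (F a b) := by
  induction w generalizing F with
  | nil => rfl
  | cons x w ih => simp [unshuffle, ih]

theorem unshuffle_add (w : List W) (F F' : List W → List W → V) :
    unshuffle w (fun a b => F a b + F' a b) = unshuffle w F + unshuffle w F' := by
  induction w generalizing F F' with
  | nil => rfl
  | cons x w ih => simp only [unshuffle, smul_add, ih]; abel

theorem unshuffle_zsmul (c : ℤ) (w : List W) (F : List W → List W → V) :
    unshuffle w (fun a b => c • F a b) = c • unshuffle w F :=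
  (map_unshuffle (DistribSMul.toAddMonoidHom V c) w F).symm

theorem unshuffle_zero (w : List W) : unshuffle w (fun _ _ => (0 : V)) = 0 :=
  (map_unshuffle (0 : V →+ V) w fun _ _ => 0).symm

theorem unshuffle_sub (w : List W) (F F' : List W → List W → V) :
    unshuffle w (fun a b => F a b - F' a b) = unshuffle w F - unshuffle w F' := by
  have := unshuffle_add w F fun a b => (-1 : ℤ) • F' a b
  rw [unshuffle_zsmul] at this
  simpa [sub_eq_add_neg] using this

theorem unshuffle_ite (P : Prop) [Decidable P] (w : List W) (F : List W → List W → V) :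
    unshuffle w (fun a b => if P then F a b else 0) = if P then unshuffle w F else 0 := by
  split_ifs
  · rfl
  · exact unshuffle_zero w

theorem unshuffle_map (t : W → W) (w : List W) (F : List W → List W → V) :
    unshuffle (w.map t) F = unshuffle w fun a b => F (a.map t) (b.map t) := by
  induction w generalizing F with
  | nil => rfl
  | cons x w ih => simp [unshuffle, ih]

theorem unshuffle_coassoc (w : List W) (F : List W → List W → List W → V) :
    unshuffle w (fun a b => unshuffle a fun c d => F c d b) =
      unshuffle w (fun a b => unshuffle b fun c d => F a c d) := by
  induction w generalizing F with
  | nil => rfl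
  | cons x w ih =>
    have e : unshuffle w (fun a b => (-1 : ℤ) ^ a.length • unshuffle a fun c d => F c d (x :: b)) =
        unshuffle w (fun a b => unshuffle a fun c d =>
          (-1 : ℤ) ^ (c.length + d.length) • F c d (x :: b)) := by
      congr 1; funext a b
      rw [← unshuffle_zsmul]
      exact unshuffle_congr fun c d h => by rw [h]
    simp only [unshuffle]
    rw [e]
    simp only [unshuffle_add, smul_add]
    simp only [← unshuffle_zsmul, smul_smul, ← pow_add]
    rw [ih fun c d b => F (x :: c) d b, ih fun c d b => (-1 : ℤ) ^ c.length • F c (x :: d) b,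
      ih fun c d b => (-1 : ℤ) ^ (c.length + d.length) • F c d (x :: b)]
    abel

theorem unshuffle_comm (w : List W) (F : List W → List W → V) :
    unshuffle w F = unshuffle w fun a b => (-1 : ℤ) ^ (a.length * b.length) • F b a := by
  induction w generalizing F with
  | nil => simp [unshuffle]
  | cons x w ih =>
    simp only [unshuffle]
    rw [ih fun a b => F (x :: a) b, ih fun a b => (-1 : ℤ) ^ a.length • F a (x :: b), add_comm]
    congr 1 <;> congr 1 <;> funext a b <;> rw [smul_smul, ← pow_add, List.length_cons]
    · ring_nf
    · congr 1
      rw [show a.length + a.length * (b.length + 1) = a.length * b.length + 2 * a.length by ring,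
        pow_add, pow_mul]
      simp

/-- Exchange of the first two subwords in a threefold unshuffle. -/
theorem unshuffle_left_comm (w : List W) (F : List W → List W → List W → V) :
    unshuffle w (fun a b => unshuffle b fun c d => F a c d) =
      unshuffle w (fun a b => unshuffle b fun c d =>
        (-1 : ℤ) ^ (a.length * c.length) • F c a d) := by
  rw [← unshuffle_coassoc, ← unshuffle_coassoc w fun a c d => _]
  exact congrArg _ (funext₂ fun a b => unshuffle_comm a fun c d => F c d b)

/-- The value of `F` on the image of the word `w` under the coderivation of the unshuffle coalgebra
that replaces a letter `x` by `G a x`, where the subword `a` of length `q` is taken out of the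
letters to the right of `x`, and applies `t` to all remaining letters. It passes each letter up to
and including `x` with the sign `(-1) ^ q`. -/
def coder (q : ℕ) (t : W → W) (G : List W → W → W) : List W → (List W → V) → V
  | [], _ => 0
  | x :: w, F => (-1 : ℤ) ^ q •
      (unshuffle w (fun a b => if a.length = q then F (G a x :: b.map t) else 0) +
        coder q t G w fun v => F (t x :: v))

variable {q : ℕ} {t : W → W} {G : List W → W → W}

theorem coder_congr {w : List W} {F F' : List W → V}
    (h : ∀ v, v.length + q = w.length → F v = F' v) : coder q t G w F = coder q t G w F' := by
  induction w generalizing F F' with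
  | nil => rfl
  | cons x w ih =>
    simp only [coder]
    congr 2
    · refine unshuffle_congr fun a b hab => ?_
      split_ifs with ha
      · exact h _ (by simp; omega)
      · rfl
    · exact ih fun v hv => h _ (by simp; omega)

theorem coder_congr_left {G' : List W → W → W} (h : ∀ a, a.length = q → G a = G' a) (w : List W)
    (F : List W → V) :
    coder q t G w F = coder q t G' w F := by
  induction w generalizing F with
  | nil => rfl
  | cons x w ih =>
    simp only [coder, ih]
    congr 3; funext a b
    split_ifs with ha
    · rw [h a ha]
    · rfl

theorem map_coder (φ : V →+ V') (w : List W) (F : List W → V) :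
    φ (coder q t G w F) = coder q t G w fun v => φ (F v) := by
  induction w generalizing F with
  | nil => simp [coder]
  | cons x w ih => simp [coder, ih, map_unshuffle, apply_ite φ]

theorem coder_add (w : List W) (F F' : List W → V) :
    coder q t G w (fun v => F v + F' v) = coder q t G w F + coder q t G w F' := by
  induction w generalizing F F' with
  | nil => simp [coder]
  | cons x w ih =>
    simp only [coder, ih, ite_add_zero, unshuffle_add, smul_add]; abel

theorem coder_zsmul (c : ℤ) (w : List W) (F : List W → V) :
    coder q t G w (fun v => c • F v) = c • coder q t G w F :=
  (map_coder (DistribSMul.toAddMonoidHom V c) w F).symm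

theorem coder_zero (w : List W) : coder q t G w (fun _ => (0 : V)) = 0 :=
  (map_coder (0 : V →+ V) w fun _ => 0).symm

theorem coder_map (s : W → W) (hs : ∀ x, s (t x) = t (s x))
    (hG : ∀ a x, s (G a x) = G (a.map s) (s x)) (w : List W) (F : List W → V) :
    coder q t G (w.map s) F = coder q t G w fun v => F (v.map s) := by
  induction w generalizing F with
  | nil => rfl
  | cons x w ih =>
    have : t ∘ s = s ∘ t := funext fun x => (hs x).symm
    simp [coder, ih, unshuffle_map, hs, hG, this]

/-- The insertion of an operation into words is a `t`-twisted coderivation for the unshuffle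
coproduct. -/
theorem coder_unshuffle (w : List W) (H : List W → List W → V) :
    coder q t G w (fun v => unshuffle v H) =
      unshuffle w fun a b => coder q t G a (fun v => H v (b.map t)) +
        (-1 : ℤ) ^ (q * a.length) • coder q t G b (fun v => H (a.map t) v) := by
  induction w generalizing H with
  | nil => simp [coder, unshuffle]
  | cons x w ih =>
    -- an insertion shortens a word by `q` letters, which changes the sign of passing `x`
    have e₁ : ∀ a b : List W, coder q t G a (fun v => (-1 : ℤ) ^ v.length • H v (t x :: b.map t)) =
        (-1 : ℤ) ^ (a.length + q) • coder q t G a (fun v => H v (t x :: b.map t)) := fun a b => by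
      rw [← coder_zsmul]
      refine coder_congr fun v hv => ?_
      rw [← hv, add_assoc, pow_add, ← two_mul, pow_mul]
      simp
    -- the letter `x` is acted upon and lands in the first subword
    have e₂ : unshuffle w (fun a b => if a.length = q then
          unshuffle (b.map t) (fun c d => H (G a x :: c) d) else 0) =
        unshuffle w (fun a b => unshuffle a fun c d =>
          if c.length = q then H (G c x :: d.map t) (b.map t) else 0) := by
      rw [unshuffle_coassoc w fun c d b =>
        if c.length = q then H (G c x :: d.map t) (b.map t) else 0]
      congr 1; funext a b
      rw [unshuffle_ite, unshuffle_map]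
    -- the letter `x` is acted upon and lands in the second subword
    have e₃ : unshuffle w (fun a b => if a.length = q then
          unshuffle (b.map t) (fun c d => (-1 : ℤ) ^ c.length • H c (G a x :: d)) else 0) =
        unshuffle w (fun a b => (-1 : ℤ) ^ (q * a.length + a.length) • unshuffle b fun c d =>
          if c.length = q then H (a.map t) (G c x :: d.map t) else 0) := by
      simp only [← unshuffle_zsmul]
      rw [unshuffle_left_comm w fun a c d => (-1 : ℤ) ^ (q * a.length + a.length) •
        if c.length = q then H (a.map t) (G c x :: d.map t) else 0]
      congr 1; funext a b
      rw [← unshuffle_ite, unshuffle_map]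
      congr 1; funext c d
      split_ifs with h
      · rw [smul_smul, ← pow_add, List.length_map, h,
          show q * c.length + (q * c.length + c.length) = c.length + 2 * (q * c.length) by ring,
          pow_add _ c.length, pow_mul]
        simp
      · simp
    simp only [unshuffle, coder, smul_add, coder_add, unshuffle_add, List.map_cons]
    simp only [ite_add_zero, unshuffle_add, smul_add]
    rw [e₂, e₃, ih fun c d => H (t x :: c) d, ih fun c d => (-1 : ℤ) ^ c.length • H c (t x :: d)]
    simp only [e₁, coder_zsmul, unshuffle_add, smul_add, ← unshuffle_zsmul, smul_smul, ← pow_add,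
      List.length_map, List.length_cons]
    have s₁ : ∀ n : ℕ, (-1 : ℤ) ^ (q + (n + q)) = (-1) ^ n := fun n => by
      rw [show q + (n + q) = n + 2 * q by ring, pow_add, pow_mul]; simp
    have s₂ : ∀ n : ℕ, q * (n + 1) = q + q * n := fun n => by ring
    have s₃ : ∀ n : ℕ, n + (q * n + q) = q + (q * n + n) := fun n => by ring
    simp only [s₁, s₂, s₃]
    abel

end Words

section

variable {K L : Type*} [Field K] [AddCommGroup L] [Module K L] {m : ℕ}
variable (A : NHomLeibniz K L m)

/-! ### Twisted representations of `End L` -/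

section Representation

variable {M : Type*} [AddCommGroup M] [Module K M]

/-- A twisted representation of `End L` on `(M, β)`: a family `ρ p`, the operators of weight `p`,
that turns twisted commutators into twisted commutators and is compatible with the twisting maps
`α` and `β`. -/
structure IsTwistedRep (ρ : ℕ → Module.End K L →ₗ[K] Module.End K M) (β : Module.End K M) :
    Prop where
  comm : ∀ (p q : ℕ) {φ φ' ψ ψ' : Module.End K L}, A.α ^ q * φ = φ' * A.α ^ q →
    A.α ^ p * ψ = ψ' * A.α ^ p →
    ρ p φ' * ρ q ψ - ρ q ψ' * ρ p φ = ρ (p + q) (φ' * ψ - ψ' * φ)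
  twist : ∀ (p q : ℕ) {φ φ' : Module.End K L}, A.α ^ q * φ = φ' * A.α ^ q →
    β ^ q * ρ p φ = ρ p φ' * β ^ q
  mul_pow : ∀ (p q : ℕ) (φ : Module.End K L), ρ (p + q) (φ * A.α ^ q) = ρ p φ * β ^ q

theorem isTwistedRep_id : A.IsTwistedRep (fun _ => LinearMap.id) A.α where
  comm _ _ _ _ _ _ _ _ := rfl
  twist _ _ _ _ h := h
  mul_pow _ _ _ := rfl

theorem αbar_pow_tprod (q : ℕ) (x : Fin m → L) :
    (A.αbar ^ q) (PiTensorProduct.tprod K x) =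
      PiTensorProduct.tprod K fun i => (A.α ^ q) (x i) := by
  induction q with
  | zero => simp
  | succ q ih =>
    rw [pow_succ', Module.End.mul_apply, ih, αbar, PiTensorProduct.map_tprod, pow_succ']
    rfl

/-- A composite of two insertions: either both act on the same factor, or on two different ones. -/
theorem insertion_comp (β γ φ ψ : Module.End K L) (x : Fin m → L) :
    insertion β φ (insertion γ ψ (PiTensorProduct.tprod K x)) =
      (∑ s : Fin m, PiTensorProduct.tprod K
        (Function.update (fun i => β (γ (x i))) s (φ (ψ (x s))))) +
      ∑ s : Fin m, ∑ r ∈ Finset.univ.erase s, PiTensorProduct.tprod K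
        (Function.update (Function.update (fun i => β (γ (x i))) s (β (ψ (x s)))) r
          (φ (γ (x r)))) := by
  simp only [insertion_tprod, map_sum]
  rw [← Finset.sum_add_distrib]
  refine Finset.sum_congr rfl fun s _ => ?_
  rw [← Finset.add_sum_erase _ _ (Finset.mem_univ s)]
  have e : (fun i => β (Function.update (fun i => γ (x i)) s (ψ (x s)) i)) =
      Function.update (fun i => β (γ (x i))) s (β (ψ (x s))) := by
    funext i
    by_cases h : i = s
    · subst h; simp
    · simp [h]
  rw [e]
  congr 1
  · simp
  · refine Finset.sum_congr rfl fun r hr => ?_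
    rw [Function.update_of_ne (Finset.ne_of_mem_erase hr)]

/-- The action of `End L` on `𝒟` by derivations, twisted by `α`. -/
theorem isTwistedRep_insertion :
    A.IsTwistedRep (M := D K L m) (fun p => insertion (A.α ^ p)) A.αbar where
  comm p q φ φ' ψ ψ' h h' := by
    have hφ : ∀ z, φ' ((A.α ^ q) z) = (A.α ^ q) (φ z) := fun z => (LinearMap.congr_fun h z).symm
    have hψ : ∀ z, ψ' ((A.α ^ p) z) = (A.α ^ p) (ψ z) := fun z => (LinearMap.congr_fun h' z).symm
    have hp : ∀ z, (A.α ^ p) ((A.α ^ q) z) = (A.α ^ (p + q)) z := fun z => by rw [pow_add]; rfl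
    have hq : ∀ z, (A.α ^ q) ((A.α ^ p) z) = (A.α ^ (p + q)) z := fun z => by
      rw [add_comm, pow_add]; rfl
    refine PiTensorProduct.ext (MultilinearMap.ext fun x => ?_)
    simp only [LinearMap.compMultilinearMap_apply, LinearMap.sub_apply, map_sub,
      Module.End.mul_apply, insertion_comp]
    simp only [insertion_tprod, hφ, hψ, hp, hq, Module.End.mul_apply]
    -- the terms in which `φ` and `ψ` act on different factors cancel
    rw [add_sub_add_comm, add_eq_left, sub_eq_zero]
    rw [Finset.sum_comm' (t' := Finset.univ) (s' := fun r => Finset.univ.erase r)]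
    · refine Finset.sum_congr rfl fun r _ => Finset.sum_congr rfl fun s hs => ?_
      rw [Function.update_comm (Finset.ne_of_mem_erase hs)]
    · intro s r
      simp [eq_comm]
  twist p q φ φ' h := by
    refine PiTensorProduct.ext (MultilinearMap.ext fun x => ?_)
    simp only [LinearMap.compMultilinearMap_apply, Module.End.mul_apply, insertion_tprod,
      αbar_pow_tprod, map_sum]
    refine Finset.sum_congr rfl fun s _ => congrArg _ (funext fun i => ?_)
    by_cases his : i = s
    · subst his
      simpa using LinearMap.congr_fun h (x i)
    · simp only [Function.update_of_ne his]
      rw [← Module.End.mul_apply, ← Module.End.mul_apply, ← pow_add, ← pow_add, add_comm]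
  mul_pow p q φ := by
    refine PiTensorProduct.ext (MultilinearMap.ext fun x => ?_)
    simp only [LinearMap.compMultilinearMap_apply, Module.End.mul_apply, insertion_tprod,
      αbar_pow_tprod, pow_add]

end Representation

/-! ### Cochains as functions on words -/

section Insertions

variable {V V' : Type*} [AddCommGroup V] [AddCommGroup V']

/-- A function on words that is additive in every letter. -/
def IsWordAdditive {W : Type*} [AddCommGroup W] (F : List W → V) : Prop :=
  ∀ l r, ∃ Ψ : W →+ V, ∀ X, F (l ++ X :: r) = Ψ X

/-- A function on words that commutes with the twisting maps. -/
def IsEquivariant (f : List (D K L m) → Module.End K L) : Prop :=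
  ∀ a, A.α * f a = f (a.map A.αbar) * A.α

variable {A} in
theorem IsEquivariant.pow {f : List (D K L m) → Module.End K L} (hf : A.IsEquivariant f) (q : ℕ)
    (a : List (D K L m)) :
    A.α ^ q * f a = f (a.map (A.αbar ^ q)) * A.α ^ q := by
  induction q with
  | zero =>
    rw [pow_zero, pow_zero, one_mul, mul_one, Module.End.one_eq_id, LinearMap.id_coe, List.map_id]
  | succ q ih =>
    have e : ⇑A.αbar ∘ ⇑(A.αbar ^ q) = ⇑(A.αbar ^ (q + 1)) := by rw [pow_succ']; rfl
    rw [pow_succ', mul_assoc, ih, ← mul_assoc, hf, mul_assoc, List.map_map, e]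

/-- Insertion of `g`, of degree `q`, into the letters of a word. -/
def wordIns (q : ℕ) (g : List (D K L m) → Module.End K L) (w : List (D K L m))
    (F : List (D K L m) → V) : V :=
  coder q (A.αbar ^ q) (fun a => insertion (A.α ^ q) (g a)) w F

/-- Insertion of `g`, of degree `q`, into the entries of `n ⊗ w`, where `w` is a word and `n` lies
in a module with a twisted representation. -/
def pointedIns {M : Type*} [AddCommGroup M] [Module K M]
    (ρ : ℕ → Module.End K L →ₗ[K] Module.End K M) (β : Module.End K M) (q : ℕ)
    (g : List (D K L m) → Module.End K L) (F : M → List (D K L m) → V) (n : M)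
    (w : List (D K L m)) : V :=
  unshuffle w (fun a b => if a.length = q then F (ρ q (g a) n) (b.map (A.αbar ^ q)) else 0) +
    A.wordIns q g w (F ((β ^ q) n))

theorem pointedIns_eq {M : Type*} [AddCommGroup M] [Module K M]
    (ρ : ℕ → Module.End K L →ₗ[K] Module.End K M) (β : Module.End K M) (q : ℕ)
    (g : List (D K L m) → Module.End K L) (F : M → List (D K L m) → V) (n : M) :
    A.pointedIns ρ β q g F n = fun w =>
      unshuffle w (fun a b => if a.length = q then F (ρ q (g a) n) (b.map (A.αbar ^ q)) else 0) +
        A.wordIns q g w (F ((β ^ q) n)) := rfl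

theorem pointedIns_zsmul {M : Type*} [AddCommGroup M] [Module K M]
    (ρ : ℕ → Module.End K L →ₗ[K] Module.End K M) (β : Module.End K M) (q : ℕ)
    (g : List (D K L m) → Module.End K L) (c : ℤ) (F : M → List (D K L m) → V) (n : M)
    (w : List (D K L m)) :
    A.pointedIns ρ β q g (fun n v => c • F n v) n w = c • A.pointedIns ρ β q g F n w := by
  simp only [pointedIns, wordIns, coder_zsmul, smul_add, ← unshuffle_zsmul, smul_ite, smul_zero]

/-- The insertion `i_f(g)`, where `g` has degree `q`, for functions on words. -/
def ins (q : ℕ) (f g : List (D K L m) → Module.End K L) (w : List (D K L m)) :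
    Module.End K L :=
  unshuffle w (fun a b => if a.length = q then f (b.map (A.αbar ^ q)) * g a else 0) +
    A.wordIns q g w f * A.α ^ q

/-- The bracket `i_f(g) - (-1)^{pq} i_g(f)`, where `f` has degree `p` and `g` has degree `q`, for
functions on words. -/
def wordBr (p q : ℕ) (f g : List (D K L m) → Module.End K L) (w : List (D K L m)) :
    Module.End K L :=
  A.ins q f g w - (-1 : ℤ) ^ (p * q) • A.ins p g f w

variable {p q : ℕ} {f g : List (D K L m) → Module.End K L}

theorem wordIns_map (hg : A.IsEquivariant g) (r : ℕ) (w : List (D K L m))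
    (F : List (D K L m) → V) :
    A.wordIns q g (w.map (A.αbar ^ r)) F = A.wordIns q g w fun v => F (v.map (A.αbar ^ r)) := by
  refine coder_map _ (fun x => ?_) (fun a x => ?_) w F
  · rw [← Module.End.mul_apply, ← Module.End.mul_apply, ← pow_add, ← pow_add, add_comm]
  · exact LinearMap.congr_fun (A.isTwistedRep_insertion.twist q r (hg.pow r a)) x

variable {M : Type*} [AddCommGroup M] [Module K M]
  {ρ : ℕ → Module.End K L →ₗ[K] Module.End K M} {β : Module.End K M}

/-- The terms of a twofold insertion: `f` and `g` act both on `n`, or one of them acts on `n` and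
the other on a letter of the word, or `g` acts on an argument of an `f` that acts on `n`, or none
acts on `n`. -/
theorem pointedIns_pointedIns (hf : A.IsEquivariant f)
    (F : M → List (D K L m) → V) (hF : ∀ v, ∃ Ψ : M →+ V, ∀ n, F n v = Ψ n) (n : M)
    (w : List (D K L m)) :
    A.pointedIns ρ β q g (A.pointedIns ρ β p f F) n w =
      unshuffle w (fun a b => unshuffle b fun c d => if a.length = q ∧ c.length = p then
        F (ρ p (f (c.map (A.αbar ^ q))) (ρ q (g a) n)) (d.map (A.αbar ^ (p + q))) else 0) +
      unshuffle w (fun a b => if a.length = q then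
        A.wordIns p f b (fun v => F ((β ^ p) (ρ q (g a) n)) (v.map (A.αbar ^ q))) else 0) +
      unshuffle w (fun a b => if a.length = p + q then
        F (ρ p (A.wordIns q g a f) ((β ^ q) n)) (b.map (A.αbar ^ (p + q))) else 0) +
      (-1 : ℤ) ^ (p * q) • unshuffle w (fun a b => if a.length = p then
        A.wordIns q g b (fun v => F (ρ p (f (a.map (A.αbar ^ q))) ((β ^ q) n))
          (v.map (A.αbar ^ p))) else 0) +
      A.wordIns q g w (fun v => A.wordIns p f v (F ((β ^ p) ((β ^ q) n)))) := by
  have hpq : ⇑(A.αbar ^ p) ∘ ⇑(A.αbar ^ q) = ⇑(A.αbar ^ (p + q)) := by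
    rw [pow_add, Module.End.mul_eq_comp, LinearMap.coe_comp]
  have e₁ : ∀ a b : List (D K L m), (if a.length = q then
      unshuffle (b.map (A.αbar ^ q)) (fun c d => if c.length = p then
        F (ρ p (f c) (ρ q (g a) n)) (d.map (A.αbar ^ p)) else 0) else 0) =
      unshuffle b fun c d => if a.length = q ∧ c.length = p then
        F (ρ p (f (c.map (A.αbar ^ q))) (ρ q (g a) n)) (d.map (A.αbar ^ (p + q))) else 0 := by
    intro a b
    rw [← unshuffle_ite, unshuffle_map]
    simp only [List.length_map, List.map_map, hpq, ite_and]
  have e₂ : A.wordIns q g w (fun v => unshuffle v fun a b => if a.length = p then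
        F (ρ p (f a) ((β ^ q) n)) (b.map (A.αbar ^ p)) else 0) =
      unshuffle w (fun a b => if a.length = p + q then
        F (ρ p (A.wordIns q g a f) ((β ^ q) n)) (b.map (A.αbar ^ (p + q))) else 0) +
      (-1 : ℤ) ^ (p * q) • unshuffle w (fun a b => if a.length = p then
        A.wordIns q g b (fun v => F (ρ p (f (a.map (A.αbar ^ q))) ((β ^ q) n))
          (v.map (A.αbar ^ p))) else 0) := by
    rw [wordIns, coder_unshuffle, unshuffle_add]
    congr 1
    · congr 1; funext a b
      obtain ⟨Ψ, hΨ⟩ := hF ((b.map (A.αbar ^ q)).map (A.αbar ^ p))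
      rw [List.map_map, hpq] at hΨ
      split_ifs with h
      · let Φ : Module.End K L →+ V := Ψ.comp
          ((LinearMap.applyₗ ((β ^ q) n)).comp (ρ p)).toAddMonoidHom
        have hΦ : ∀ φ, F (ρ p φ ((β ^ q) n)) (b.map (A.αbar ^ (p + q))) = Φ φ := fun φ => hΨ _
        rw [hΦ, wordIns, map_coder]
        refine coder_congr fun v hv => ?_
        rw [if_pos (by omega), List.map_map, hpq, hΦ]
      · refine (coder_congr fun v hv => ?_).trans (coder_zero a)
        rw [if_neg (by omega)]
    · rw [← unshuffle_zsmul]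
      congr 1; funext a b
      simp only [List.length_map]
      split_ifs with h
      · rw [h, mul_comm q p]
        rfl
      · simp [coder_zero]
  simp only [A.pointedIns_eq, ite_add_zero, unshuffle_add]
  simp only [e₁]
  have e₃ : A.wordIns q g w (fun v => (unshuffle v fun a b => if a.length = p then
        F (ρ p (f a) ((β ^ q) n)) (b.map (A.αbar ^ p)) else 0) +
        A.wordIns p f v (F ((β ^ p) ((β ^ q) n)))) =
      A.wordIns q g w (fun v => unshuffle v fun a b => if a.length = p then
        F (ρ p (f a) ((β ^ q) n)) (b.map (A.αbar ^ p)) else 0) +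
      A.wordIns q g w (fun v => A.wordIns p f v (F ((β ^ p) ((β ^ q) n)))) := coder_add _ _ _
  rw [e₃, e₂]
  simp only [A.wordIns_map hf]
  abel

/-- The contribution to the commutator of two insertions in which both operations act on `n`. -/
theorem unshuffle_comm_sub (hρ : A.IsTwistedRep ρ β) (hf : A.IsEquivariant f)
    (hg : A.IsEquivariant g) (F : M → List (D K L m) → V)
    (hF : ∀ v, ∃ Ψ : M →+ V, ∀ n, F n v = Ψ n) (n : M) (w : List (D K L m)) :
    unshuffle w (fun a b => unshuffle b fun c d => if a.length = q ∧ c.length = p then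
        F (ρ p (f (c.map (A.αbar ^ q))) (ρ q (g a) n)) (d.map (A.αbar ^ (p + q))) else 0) -
      (-1 : ℤ) ^ (p * q) •
        unshuffle w (fun a b => unshuffle b fun c d => if a.length = p ∧ c.length = q then
          F (ρ q (g (c.map (A.αbar ^ p))) (ρ p (f a) n)) (d.map (A.αbar ^ (p + q))) else 0) =
    unshuffle w (fun a b => if a.length = p + q then F (ρ (p + q)
      (unshuffle a (fun c d => if c.length = q then f (d.map (A.αbar ^ q)) * g c else 0) -
        (-1 : ℤ) ^ (p * q) •
          unshuffle a (fun c d => if c.length = p then g (d.map (A.αbar ^ p)) * f c else 0)) n)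
      (b.map (A.αbar ^ (p + q))) else 0) := by
  have hsq : ∀ k : ℕ, (-1 : ℤ) ^ k * (-1 : ℤ) ^ k = 1 := fun k => by
    rw [← pow_add, ← two_mul, pow_mul]; simp
  have e : ∀ a, unshuffle a (fun c d => if c.length = p then g (d.map (A.αbar ^ p)) * f c else 0) =
      unshuffle a fun c d => (-1 : ℤ) ^ (c.length * d.length) •
        if d.length = p then g (c.map (A.αbar ^ p)) * f d else 0 := fun a => unshuffle_comm a _
  simp only [e]
  rw [unshuffle_left_comm w fun a c d => if a.length = p ∧ c.length = q then
    F (ρ q (g (c.map (A.αbar ^ p))) (ρ p (f a) n)) (d.map (A.αbar ^ (p + q))) else 0]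
  simp only [← unshuffle_zsmul, ← unshuffle_sub]
  rw [← unshuffle_coassoc w fun a c d => (if a.length = q ∧ c.length = p then
    F (ρ p (f (c.map (A.αbar ^ q))) (ρ q (g a) n)) (d.map (A.αbar ^ (p + q))) else 0) -
    (-1 : ℤ) ^ (p * q) • (-1 : ℤ) ^ (a.length * c.length) • if c.length = p ∧ a.length = q then
    F (ρ q (g (a.map (A.αbar ^ p))) (ρ p (f c) n)) (d.map (A.αbar ^ (p + q))) else 0]
  congr 1; funext a b
  obtain ⟨Ψ, hΨ⟩ := hF (b.map (A.αbar ^ (p + q)))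
  let Φ : Module.End K L →+ V := Ψ.comp ((LinearMap.applyₗ n).comp (ρ (p + q))).toAddMonoidHom
  have hΦ : ∀ φ, F (ρ (p + q) φ n) (b.map (A.αbar ^ (p + q))) = Φ φ := fun φ => hΨ _
  rw [hΦ, map_unshuffle, ← unshuffle_ite]
  refine unshuffle_congr fun c d hcd => ?_
  by_cases h : c.length = q ∧ d.length = p
  · obtain ⟨hc, hd⟩ := h
    rw [if_pos ⟨hc, hd⟩, if_pos ⟨hd, hc⟩, if_pos (by omega), if_pos hc, if_pos hd, hc, hd,
      smul_smul, smul_smul, mul_comm q p, hsq, one_smul, one_smul, ← hΦ,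
      ← hρ.comm p q (hf.pow q d) (hg.pow p c), hΨ, hΨ, hΨ, ← map_sub]
    rfl
  · rw [if_neg h, if_neg fun h' => h h'.symm, smul_zero, smul_zero, sub_zero]
    by_cases ha : a.length = p + q
    · rw [if_neg (show ¬c.length = q by omega), if_neg (show ¬d.length = p by omega)]
      simp
    · rw [if_neg ha]

theorem IsWordAdditive.cons {W : Type*} [AddCommGroup W] {F : List W → V} (hF : IsWordAdditive F)
    (x : W) : IsWordAdditive fun v => F (x :: v) := fun l r => hF (x :: l) r

theorem wordIns_cons (x : D K L m) (w : List (D K L m)) (F : List (D K L m) → V) :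
    A.wordIns q g (x :: w) F = (-1 : ℤ) ^ q • A.pointedIns (fun k => insertion (A.α ^ k)) A.αbar q g
      (fun y v => F (y :: v)) x w := rfl

/-- If insertions into the letters of `w` have the expected commutator, then so have insertions
into the entries of `n ⊗ w`. -/
theorem pointedIns_comm (hρ : A.IsTwistedRep ρ β) (hf : A.IsEquivariant f)
    (hg : A.IsEquivariant g) (F : M → List (D K L m) → V)
    (hF : ∀ v, ∃ Ψ : M →+ V, ∀ n, F n v = Ψ n) (n : M) (w : List (D K L m))
    (hw : A.wordIns q g w (fun v => A.wordIns p f v (F ((β ^ (p + q)) n))) -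
      (-1 : ℤ) ^ (p * q) • A.wordIns p f w (fun v => A.wordIns q g v (F ((β ^ (p + q)) n))) =
      A.wordIns (p + q) (A.wordBr p q f g) w (F ((β ^ (p + q)) n))) :
    A.pointedIns ρ β q g (A.pointedIns ρ β p f F) n w -
      (-1 : ℤ) ^ (p * q) • A.pointedIns ρ β p f (A.pointedIns ρ β q g F) n w =
      A.pointedIns ρ β (p + q) (A.wordBr p q f g) F n w := by
  have hsq : ∀ k : ℕ, (-1 : ℤ) ^ k * (-1 : ℤ) ^ k = 1 := fun k => by
    rw [← pow_add, ← two_mul, pow_mul]; simp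
  have hβ : (β ^ p) ((β ^ q) n) = (β ^ (p + q)) n := by rw [pow_add]; rfl
  have hβ' : (β ^ q) ((β ^ p) n) = (β ^ (p + q)) n := by rw [add_comm, pow_add]; rfl
  have t₁ : ∀ a, (β ^ p) (ρ q (g a) n) = ρ q (g (a.map (A.αbar ^ p))) ((β ^ p) n) := fun a =>
    LinearMap.congr_fun (hρ.twist q p (hg.pow p a)) n
  have t₂ : ∀ a, (β ^ q) (ρ p (f a) n) = ρ p (f (a.map (A.αbar ^ q))) ((β ^ q) n) := fun a =>
    LinearMap.congr_fun (hρ.twist p q (hf.pow q a)) n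
  have t₃ : ∀ a, ρ p (A.wordIns q g a f) ((β ^ q) n) =
      ρ (p + q) (A.wordIns q g a f * A.α ^ q) n := fun a =>
    (LinearMap.congr_fun (hρ.mul_pow p q _) n).symm
  have t₄ : ∀ a, ρ q (A.wordIns p f a g) ((β ^ p) n) =
      ρ (p + q) (A.wordIns p f a g * A.α ^ p) n := fun a => by
    rw [add_comm p q]; exact (LinearMap.congr_fun (hρ.mul_pow q p _) n).symm
  -- on the right, `[f, g]` acts on `n`: composites of values, and nested insertions
  have e : unshuffle w (fun a b => if a.length = p + q then
        F (ρ (p + q) (A.wordBr p q f g a) n) (b.map (A.αbar ^ (p + q))) else 0) =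
      unshuffle w (fun a b => if a.length = p + q then F (ρ (p + q)
        (unshuffle a (fun c d => if c.length = q then f (d.map (A.αbar ^ q)) * g c else 0) -
          (-1 : ℤ) ^ (p * q) •
            unshuffle a (fun c d => if c.length = p then g (d.map (A.αbar ^ p)) * f c else 0)) n)
        (b.map (A.αbar ^ (p + q))) else 0) +
      (unshuffle w (fun a b => if a.length = p + q then
        F (ρ p (A.wordIns q g a f) ((β ^ q) n)) (b.map (A.αbar ^ (p + q))) else 0) -
      (-1 : ℤ) ^ (p * q) • unshuffle w (fun a b => if a.length = p + q then
        F (ρ q (A.wordIns p f a g) ((β ^ p) n)) (b.map (A.αbar ^ (p + q))) else 0)) := by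
    rw [← unshuffle_zsmul, ← unshuffle_sub, ← unshuffle_add]
    congr 1; funext a b
    obtain ⟨Ψ, hΨ⟩ := hF (b.map (A.αbar ^ (p + q)))
    let Φ : Module.End K L →+ V := Ψ.comp ((LinearMap.applyₗ n).comp (ρ (p + q))).toAddMonoidHom
    have hΦ : ∀ φ, F (ρ (p + q) φ n) (b.map (A.αbar ^ (p + q))) = Φ φ := fun φ => hΨ _
    split_ifs with h
    · simp only [t₃, t₄, hΦ, ← map_zsmul, ← map_sub, ← map_add]
      congr 1
      simp only [wordBr, ins, smul_add]
      abel
    · simp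
  have hqp : q + p = p + q := add_comm q p
  have hqp' : q * p = p * q := mul_comm q p
  rw [A.pointedIns_pointedIns hf F hF, A.pointedIns_pointedIns hg F hF, pointedIns, e, ← hw,
    ← A.unshuffle_comm_sub hρ hf hg F hF]
  simp only [hβ, hβ', t₁, t₂, hqp, hqp', smul_add, smul_smul, hsq, one_smul]
  abel

/-- The insertions `R_f` into words form a twisted representation: their graded commutator is the
insertion of the bracket. -/
theorem wordIns_comm (hf : A.IsEquivariant f) (hg : A.IsEquivariant g) (w : List (D K L m))
    {F : List (D K L m) → V} (hF : IsWordAdditive F) :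
    A.wordIns q g w (fun v => A.wordIns p f v F) -
      (-1 : ℤ) ^ (p * q) • A.wordIns p f w (fun v => A.wordIns q g v F) =
      A.wordIns (p + q) (A.wordBr p q f g) w F := by
  induction w generalizing F with
  | nil => simp [wordIns, coder]
  | cons x w ih =>
    have h := A.pointedIns_comm A.isTwistedRep_insertion hf hg (fun y v => F (y :: v))
      (fun v => hF [] v) x w (ih (hF.cons _))
    rw [wordIns_cons A x w F, ← h]
    have e : ∀ (p q : ℕ) (f g : List (D K L m) → Module.End K L),
        A.wordIns q g (x :: w) (fun v => A.wordIns p f v F) = (-1 : ℤ) ^ (p + q) •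
          A.pointedIns (fun k => insertion (A.α ^ k)) A.αbar q g
            (A.pointedIns (fun k => insertion (A.α ^ k)) A.αbar p f (fun y v => F (y :: v))) x w :=
      fun p q f g => by
        rw [wordIns_cons, pow_add, mul_comm, mul_smul,
          ← A.pointedIns_zsmul _ _ _ _ ((-1 : ℤ) ^ p)]
        rfl
    rw [e, e, add_comm q p, smul_sub, smul_comm ((-1 : ℤ) ^ (p * q))]

/-- The bracket acts on the right by graded commutators. -/
theorem ins_wordBr (hf : A.IsEquivariant f) (hg : A.IsEquivariant g) {h : List (D K L m) →
    Module.End K L} (hh : IsWordAdditive h) (w : List (D K L m)) :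
    A.ins (p + q) h (A.wordBr p q f g) w =
      A.ins q (A.ins p h f) g w - (-1 : ℤ) ^ (p * q) • A.ins p (A.ins q h g) f w := by
  have e : ∀ (q : ℕ) (h g : List (D K L m) → Module.End K L) (w : List (D K L m)) (z : L),
      A.ins q h g w z = A.pointedIns (fun _ => LinearMap.id) A.α q g (fun z v => h v z) z w := by
    intro q h g w z
    have e₁ := map_unshuffle (LinearMap.applyₗ (R := K) z : Module.End K L →ₗ[K] L).toAddMonoidHom w
      (fun a b => if a.length = q then h (b.map (A.αbar ^ q)) * g a else 0)
    have e₂ := map_coder (q := q) (t := A.αbar ^ q) (G := fun a => insertion (A.α ^ q) (g a))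
      (LinearMap.applyₗ (R := K) ((A.α ^ q) z) : Module.End K L →ₗ[K] L).toAddMonoidHom w h
    rw [ins, LinearMap.add_apply]
    refine (congrArg₂ (· + ·) e₁ e₂).trans ?_
    simp only [pointedIns, wordIns]
    congr 2
    funext a b
    split_ifs <;> simp
  refine LinearMap.ext fun z => ?_
  have key := A.pointedIns_comm (p := p) (q := q) A.isTwistedRep_id hf hg (fun z v => h v z)
    (fun v => ⟨(h v).toAddMonoidHom, fun _ => rfl⟩) z w
    (A.wordIns_comm hf hg w fun l r => by
      obtain ⟨Ψ, hΨ⟩ := hh l r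
      exact ⟨(LinearMap.applyₗ (R := K) _ : Module.End K L →ₗ[K] L).toAddMonoidHom.comp Ψ,
        fun X => by rw [hΨ]; rfl⟩)
  have e' : ∀ (q : ℕ) (h g : List (D K L m) → Module.End K L), (fun z v => A.ins q h g v z) =
      A.pointedIns (fun _ => LinearMap.id) A.α q g (fun z v => h v z) := fun q h g =>
    funext₂ fun z v => e q h g v z
  rw [LinearMap.sub_apply, LinearMap.smul_apply, e, e, e, ← key, e', e']

end Insertions

end

/-! ### Shuffle permutations -/

section Shuffles

variable {W V : Type*} [AddCommGroup V]

theorem ofFn_eq_take_append_drop {N : ℕ} (Y : Fin (N + 1) → W) (i : Fin (N + 1)) :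
    List.ofFn Y = (List.ofFn fun j => Y (i.succAbove j)).take i ++
      Y i :: (List.ofFn fun j => Y (i.succAbove j)).drop i := by
  refine List.ext_getElem (by simp; omega) fun n h₁ h₂ => ?_
  have hi := i.is_lt
  rw [List.getElem_append]
  simp only [List.length_take, List.length_ofFn, List.getElem_take, List.getElem_ofFn,
    List.getElem_cons, List.getElem_drop]
  have hn : n < N + 1 := by simpa using h₁
  split_ifs with h h'
  · congr 1
    rw [Fin.succAbove_of_castSucc_lt _ _ (by rw [Fin.lt_def]; simp at h ⊢; omega)]
    rfl
  · congr 1; ext; simp; omega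
  · congr 1
    rw [Fin.succAbove_of_le_castSucc _ _ (by rw [Fin.le_def]; simp)]
    ext; simp; omega

theorem mem_shuffles_succ_decomposeFin {k q N : ℕ} (i : Fin (N + 1)) (σ : Equiv.Perm (Fin N)) :
    Equiv.Perm.decomposeFin.symm (i, σ) ∈ shuffles (k + 1) q (N + 1) ↔
      i = 0 ∧ σ ∈ shuffles k q N := by
  by_cases hi : i = 0
  · subst hi
    simp [shuffles, Fin.forall_fin_succ, Equiv.Perm.decomposeFin_symm_apply_succ,
      Equiv.Perm.decomposeFin_symm_apply_zero, add_right_comm k 1 q]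
  · simp only [hi, false_and, iff_false]
    intro h
    have := (Finset.mem_filter.mp h).2.1 0 (by simp)
    rw [Equiv.Perm.decomposeFin_symm_apply_zero] at this
    exact hi this

theorem mem_shuffles_zero_succ_decomposeFin {q N : ℕ} (σ : Equiv.Perm (Fin N)) :
    Equiv.Perm.decomposeFin.symm (0, σ) ∈ shuffles 0 (q + 1) (N + 1) ↔ σ ∈ shuffles 0 q N := by
  simp [shuffles, Fin.forall_fin_succ, Equiv.Perm.decomposeFin_symm_apply_succ,
      Equiv.Perm.decomposeFin_symm_apply_zero]

/-- Composition with the cycle makes the first point the image of the first point of the second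
block. -/
theorem mem_shuffles_mul_cycleRange {q N : ℕ} (hq : q < N + 1) (σ : Equiv.Perm (Fin N)) :
    Equiv.Perm.decomposeFin.symm (0, σ) * Fin.cycleRange ⟨q, hq⟩ ∈ shuffles 0 q (N + 1) ↔
      σ ∈ shuffles 0 q N := by
  set p : Fin (N + 1) := ⟨q, hq⟩ with hp
  have hpq : (p : ℕ) = q := rfl
  have h₁ : ∀ j : Fin N, (p.succAbove j : ℕ) < q ↔ (j : ℕ) < q := fun j => by
    rw [Fin.succAbove]
    split_ifs with h <;> rw [Fin.lt_def] at h <;> simp at h ⊢; omega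
  have h₂ : ∀ j : Fin N, q ≤ (p.succAbove j : ℕ) ↔ q ≤ (j : ℕ) := fun j => by
    rw [← not_lt, h₁, not_lt]
  have h₃ : ∀ j : Fin N, p < p.succAbove j ↔ q ≤ (j : ℕ) := fun j => by
    rw [← h₂, Fin.lt_def, hpq]
    have : (p.succAbove j : ℕ) ≠ q := fun e => Fin.succAbove_ne p j (Fin.ext e)
    omega
  have h₄ : ∀ j : Fin N, p.succAbove j < p ↔ (j : ℕ) < q := fun j => by
    rw [← h₁, Fin.lt_def, hpq]
  simp [shuffles, Fin.forall_iff_succAbove p, Fin.cycleRange_succAbove, h₁, h₂, h₃, h₄, hpq,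
    Equiv.Perm.decomposeFin_symm_apply_succ, Equiv.Perm.decomposeFin_symm_apply_zero]

theorem sign_decomposeFin_zero {N : ℕ} (σ : Equiv.Perm (Fin N)) :
    Equiv.Perm.sign (Equiv.Perm.decomposeFin.symm (0, σ)) = Equiv.Perm.sign σ := by
  simp

/-- A sum over permutations fixing the first point. -/
theorem sum_perm_fix_zero {N : ℕ} (F : Equiv.Perm (Fin (N + 1)) → V)
    (hF : ∀ i σ, i ≠ 0 → F (Equiv.Perm.decomposeFin.symm (i, σ)) = 0) :
    ∑ σ, F σ = ∑ σ : Equiv.Perm (Fin N), F (Equiv.Perm.decomposeFin.symm (0, σ)) := by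
  rw [← Equiv.Perm.decomposeFin.symm.sum_comp, Fintype.sum_prod_type]
  exact Fintype.sum_eq_single 0 fun i hi => Finset.sum_eq_zero fun σ _ => hF i σ hi

theorem sum_shuffles_succ {k q N : ℕ} (F : Equiv.Perm (Fin (N + 1)) → V) :
    ∑ σ ∈ shuffles (k + 1) q (N + 1), F σ =
      ∑ σ ∈ shuffles k q N, F (Equiv.Perm.decomposeFin.symm (0, σ)) := by
  rw [← Fintype.sum_ite_mem, sum_perm_fix_zero, ← Fintype.sum_ite_mem]
  · simp [mem_shuffles_succ_decomposeFin]
  · intro i σ hi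
    simp [mem_shuffles_succ_decomposeFin, hi]

/-- A shuffle that moves the first point, or whose first block is empty, sends the first point of
its second block to the first point. -/
theorem apply_zero_of_mem_shuffles {q N : ℕ} {σ : Equiv.Perm (Fin (N + 1))}
    (hσ : σ ∈ shuffles 0 q (N + 1)) (h : σ 0 ≠ 0 ∨ q = 0) : ∃ hq : q < N + 1, σ ⟨q, hq⟩ = 0 := by
  obtain ⟨-, h₁, h₂⟩ := (Finset.mem_filter.mp hσ).2
  have hj : σ (σ.symm 0) = 0 := σ.apply_symm_apply 0
  generalize σ.symm 0 = j at hj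
  have hjq : q ≤ (j : ℕ) := by
    by_contra hlt
    have h0 : (0 : Fin (N + 1)) < j := by
      refine Fin.pos_of_ne_zero fun e => ?_
      subst e
      rcases h with h | h
      · exact h hj
      · omega
    have := h₁ 0 j (by simp) h0 (by omega)
    rw [hj] at this
    exact absurd this (Fin.not_lt_zero _)
  refine ⟨by omega, ?_⟩
  rcases hjq.eq_or_lt with e | hlt
  · rw [← hj]; congr 1; ext; exact e
  · have := h₂ ⟨q, by omega⟩ j (by simp) (by rw [Fin.lt_def]; exact hlt)
    rw [hj] at this
    exact absurd this (Fin.not_lt_zero _)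

/-- The shuffles that send the first letter of the second block to the first place. -/
theorem sum_shuffles_cycleRange {q N : ℕ} (hq : q < N + 1) (F : Equiv.Perm (Fin (N + 1)) → V) :
    ∑ σ ∈ shuffles 0 q (N + 1), (if σ ⟨q, hq⟩ = 0 then F σ else 0) =
      ∑ σ ∈ shuffles 0 q N, F (Equiv.Perm.decomposeFin.symm (0, σ) * Fin.cycleRange ⟨q, hq⟩) := by
  have e : ∀ (i : Fin (N + 1)) (σ : Equiv.Perm (Fin N)),
      (Equiv.Perm.decomposeFin.symm (i, σ) * Fin.cycleRange ⟨q, hq⟩) ⟨q, hq⟩ = i := fun i σ => by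
    rw [Equiv.Perm.mul_apply, Fin.cycleRange_self, Equiv.Perm.decomposeFin_symm_apply_zero]
  rw [← Fintype.sum_ite_mem, ← Equiv.sum_comp (Equiv.mulRight (Fin.cycleRange ⟨q, hq⟩)),
    sum_perm_fix_zero, ← Fintype.sum_ite_mem (shuffles 0 q N)]
  · simp only [Equiv.coe_mulRight, e, mem_shuffles_mul_cycleRange, if_true]
  · intro i σ hi
    simp only [Equiv.coe_mulRight, e, hi, if_false, ite_self]

/-- The signed sum of the values of `Φ` on the unshuffles of the word `w`, with first block of
length `q`, that fix its first `k` letters. It is zero if `w` has less than `k` letters. -/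
def unshuffleFrom : ℕ → ℕ → List W → (List W → V) → V
  | 0, q, w, Φ => unshuffle w fun a b => if a.length = q then Φ (a ++ b) else 0
  | _ + 1, _, [], _ => 0
  | k + 1, q, x :: w, Φ => unshuffleFrom k q w fun v => Φ (x :: v)

/-- The first letter of the word is the first letter of one of the two blocks; for the second block,
the sign of passing the `q` letters of the first block appears. -/
theorem sum_shuffles_zero {q N : ℕ} (hq : q ≤ N) (X : Fin N → W) (Φ : List W → V) :
    ∑ σ ∈ shuffles 0 q N, (Equiv.Perm.sign σ : ℤ) • Φ (List.ofFn fun i => X (σ i)) =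
      unshuffleFrom 0 q (List.ofFn X) Φ := by
  induction N generalizing q Φ with
  | zero =>
    obtain rfl : q = 0 := by omega
    have : shuffles 0 0 0 = Finset.univ := Finset.filter_true_of_mem fun σ _ =>
      ⟨fun i => i.elim0, fun i => i.elim0, fun i => i.elim0⟩
    simp [this, unshuffleFrom, unshuffle]
  | succ N ih =>
    have e₁ : ∀ σ : Equiv.Perm (Fin N), (List.ofFn fun i =>
        X (Equiv.Perm.decomposeFin.symm (0, σ) i)) = X 0 :: List.ofFn fun i => X (σ i).succ :=
      fun σ => by
        rw [List.ofFn_succ]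
        simp [Equiv.Perm.decomposeFin_symm_apply_succ, Equiv.Perm.decomposeFin_symm_apply_zero]
    have e₂ : ∀ (hq' : q < N + 1) (σ : Equiv.Perm (Fin N)), (List.ofFn fun i =>
        X ((Equiv.Perm.decomposeFin.symm (0, σ) * Fin.cycleRange ⟨q, hq'⟩) i)) =
        (List.ofFn fun i => X (σ i).succ).take q ++
          X 0 :: (List.ofFn fun i => X (σ i).succ).drop q := fun hq' σ => by
      rw [ofFn_eq_take_append_drop _ ⟨q, hq'⟩]
      simp [Equiv.Perm.decomposeFin_symm_apply_succ, Equiv.Perm.decomposeFin_symm_apply_zero,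
        Fin.cycleRange_succAbove, Fin.cycleRange_self]
    -- the second half of the recursion: the first letter goes to the second block
    have e₃ : ∀ hq' : q < N + 1, ∑ σ ∈ shuffles 0 q (N + 1), (if σ ⟨q, hq'⟩ = 0 then
        (Equiv.Perm.sign σ : ℤ) • Φ (List.ofFn fun i => X (σ i)) else 0) =
        unshuffle (List.ofFn fun i => X i.succ) fun a b => (-1 : ℤ) ^ a.length •
          if a.length = q then Φ (a ++ X 0 :: b) else 0 := fun hq' => by
      rw [sum_shuffles_cycleRange]
      simp only [e₂, Equiv.Perm.sign_mul, sign_decomposeFin_zero, Fin.sign_cycleRange]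
      have := ih (by omega : q ≤ N) (fun i => X i.succ)
        fun v => (-1 : ℤ) ^ q • Φ (v.take q ++ X 0 :: v.drop q)
      simp only [smul_smul] at this
      push_cast
      rw [this, unshuffleFrom]
      congr 1; funext a b
      split_ifs with h
      · subst h; simp
      · simp
    rw [List.ofFn_succ, unshuffleFrom, unshuffle]
    rcases q with _ | q
    · rw [← e₃ (by omega)]
      have : unshuffle (List.ofFn fun i => X i.succ)
          (fun a b => if (X 0 :: a).length = 0 then Φ (X 0 :: a ++ b) else 0) = 0 := by
        simp [unshuffle_zero]
      rw [this, zero_add]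
      refine Finset.sum_congr rfl fun σ hσ => ?_
      rw [if_pos (apply_zero_of_mem_shuffles hσ (Or.inr rfl)).2]
    · have h₁ : ∑ σ ∈ shuffles 0 (q + 1) (N + 1), (if σ 0 = 0 then
          (Equiv.Perm.sign σ : ℤ) • Φ (List.ofFn fun i => X (σ i)) else 0) =
          unshuffle (List.ofFn fun i => X i.succ) fun a b =>
            if (X 0 :: a).length = q + 1 then Φ (X 0 :: a ++ b) else 0 := by
        rw [← Fintype.sum_ite_mem, sum_perm_fix_zero]
        · simp only [mem_shuffles_zero_succ_decomposeFin, Equiv.Perm.decomposeFin_symm_apply_zero,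
            if_true, Fintype.sum_ite_mem, sign_decomposeFin_zero, e₁]
          rw [ih (by omega) (fun i => X i.succ) fun v => Φ (X 0 :: v), unshuffleFrom]
          simp
        · intro i σ hi
          simp [Equiv.Perm.decomposeFin_symm_apply_zero, hi]
      have h₂ : ∑ σ ∈ shuffles 0 (q + 1) (N + 1), (if σ 0 ≠ 0 then
          (Equiv.Perm.sign σ : ℤ) • Φ (List.ofFn fun i => X (σ i)) else 0) =
          unshuffle (List.ofFn fun i => X i.succ) fun a b => (-1 : ℤ) ^ a.length •
            if a.length = q + 1 then Φ (a ++ X 0 :: b) else 0 := by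
        by_cases hq' : q + 1 < N + 1
        · rw [← e₃ hq']
          refine Finset.sum_congr rfl fun σ hσ => ?_
          by_cases h : σ 0 = 0
          · rw [if_neg (not_not.mpr h), if_neg]
            intro h'
            simpa using σ.injective (h'.trans h.symm)
          · rw [if_pos h, if_pos (apply_zero_of_mem_shuffles hσ (Or.inl h)).2]
        · rw [Finset.sum_eq_zero fun σ hσ => if_neg fun h =>
            hq' (apply_zero_of_mem_shuffles hσ (Or.inl h)).1]
          refine (unshuffle_zero _).symm.trans (unshuffle_congr fun a b hab => ?_)
          rw [List.length_ofFn] at hab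
          rw [if_neg (by omega), smul_zero]
      rw [← h₁, ← h₂, ← Finset.sum_add_distrib]
      refine Finset.sum_congr rfl fun σ _ => ?_
      by_cases h : σ 0 = 0 <;> simp [h]

/-- The signed sum over shuffles that fix the first `k` letters, as a sum over splittings of a
word. -/
theorem sum_shuffles {k q N : ℕ} (hq : k + q ≤ N) (X : Fin N → W) (Φ : List W → V) :
    ∑ σ ∈ shuffles k q N, (Equiv.Perm.sign σ : ℤ) • Φ (List.ofFn fun i => X (σ i)) =
      unshuffleFrom k q (List.ofFn X) Φ := by
  induction k generalizing N Φ with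
  | zero => exact sum_shuffles_zero (by omega) X Φ
  | succ k ih =>
    obtain ⟨N, rfl⟩ : ∃ M, N = M + 1 := ⟨N - 1, by omega⟩
    rw [sum_shuffles_succ, List.ofFn_succ, unshuffleFrom,
      ← ih (by omega) (fun i => X i.succ) fun v => Φ (X 0 :: v)]
    refine Finset.sum_congr rfl fun σ _ => ?_
    rw [sign_decomposeFin_zero, List.ofFn_succ]
    simp [Equiv.Perm.decomposeFin_symm_apply_succ, Equiv.Perm.decomposeFin_symm_apply_zero]

variable {q : ℕ} {t : W → W} {G : List W → W → W}

theorem coder_eq_zero {w : List W} (hw : w.length ≤ q) (F : List W → V) :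
    coder q t G w F = 0 := by
  induction w generalizing F with
  | nil => rfl
  | cons x w ih =>
    rw [List.length_cons] at hw
    have e : unshuffle w (fun a b => if a.length = q then F (G a x :: b.map t) else 0) = 0 :=
      (unshuffle_congr fun a b hab => if_neg (by omega)).trans (unshuffle_zero w)
    rw [coder, ih (by omega), e, add_zero, smul_zero]

/-- A coderivation as a sum over the position of the letter that is acted upon. -/
theorem coder_eq_sum [Zero W] {p : ℕ} {w : List W} (hw : w.length = p + q) (F : List W → V) :
    coder q t G w F = ∑ k : Fin p, (-1 : ℤ) ^ (((k : ℕ) + 1) * q) •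
      unshuffleFrom (k + 1) q w fun v => F ((v.take k).map t ++
        G ((v.drop (k + 1)).take q) (v.getD k 0) :: (v.drop (k + 1 + q)).map t) := by
  induction p generalizing w F with
  | zero => simpa using coder_eq_zero (by omega) F
  | succ p ih =>
    obtain ⟨x, w, rfl⟩ := List.exists_cons_of_length_eq_add_one (hw.trans (add_right_comm p 1 q))
    rw [Fin.sum_univ_succ, coder, ih (by simp at hw; omega), smul_add, Finset.smul_sum]
    congr 1
    · simp only [Fin.val_zero, zero_add, one_mul, unshuffleFrom]
      congr 2; funext a b
      split_ifs with h
      · subst h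
        simp [add_comm 1]
      · rfl
    · refine Finset.sum_congr rfl fun k _ => ?_
      rw [smul_smul, ← pow_add]
      congr 1
      · simp; ring_nf
      · simp [unshuffleFrom, add_right_comm _ 1 q]

end Shuffles

/-! ### Unshuffles of a single letter -/

section Single

variable {W V : Type*} [AddCommGroup V]

/-- The only splitting with the full word on the left. -/
theorem unshuffle_length_eq (w : List W) (H : List W → List W → V) :
    unshuffle w (fun a b => if a.length = w.length then H a b else 0) = H w [] := by
  induction w generalizing H with
  | nil => rfl
  | cons x w ih =>
    have e : unshuffle w (fun a b => (-1 : ℤ) ^ a.length •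
        if a.length = (x :: w).length then H a (x :: b) else 0) = 0 :=
      (unshuffle_congr fun a b hab => by
        rw [if_neg (by rw [List.length_cons]; omega), smul_zero]).trans (unshuffle_zero w)
    rw [unshuffle, e, add_zero, ← ih fun a b => H (x :: a) b]
    simp

theorem unshuffle_length_zero (w : List W) (H : List W → List W → V) :
    unshuffle w (fun a b => if a.length = 0 then H a b else 0) = H [] w := by
  rw [unshuffle_comm, ← unshuffle_length_eq w fun a b => H b a]
  refine unshuffle_congr fun a b hab => ?_
  by_cases h : b.length = 0
  · rw [if_pos h, if_pos (by omega), h, mul_zero, pow_zero, one_smul]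
  · rw [if_neg h, if_neg (by omega), smul_zero]

theorem unshuffle_length_one {N : ℕ} (X : Fin (N + 1) → W) (H : List W → List W → V) :
    unshuffle (List.ofFn X) (fun a b => if a.length = 1 then H a b else 0) =
      ∑ j : Fin (N + 1), (-1 : ℤ) ^ (j : ℕ) • H [X j] (List.ofFn fun l => X (j.succAbove l)) := by
  induction N generalizing H with
  | zero => simp [unshuffle]
  | succ N ih =>
    rw [List.ofFn_succ, unshuffle, Fin.sum_univ_succ]
    congr 1
    · simpa using unshuffle_length_zero (List.ofFn fun i => X i.succ) fun a b => H (X 0 :: a) b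
    · have := ih (fun i => X i.succ) fun a b => (-1 : ℤ) ^ 1 • H a (X 0 :: b)
      refine Eq.trans ?_ (this.trans ?_)
      · congr 1; funext a b
        split_ifs with h
        · rw [h]
        · rw [smul_zero]
      · refine Finset.sum_congr rfl fun j _ => ?_
        rw [smul_smul, ← pow_add, List.ofFn_succ]
        simp

variable {t : W → W} {G : List W → W → W}

theorem coder_one {N : ℕ} (X : Fin (N + 1) → W) (F : List W → V) :
    coder 1 t G (List.ofFn X) F = ∑ j : Fin (N + 1), ∑ i ∈ Finset.univ.filter (fun i => i < j),
      (-1 : ℤ) ^ (j : ℕ) • F (List.ofFn fun l =>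
        if j.succAbove l = i then G [X j] (X i) else t (X (j.succAbove l))) := by
  induction N generalizing F with
  | zero => simp [coder, unshuffle]
  | succ N ih =>
    rw [List.ofFn_succ, coder, unshuffle_length_one, ih,
      Fin.sum_univ_succ (n := N + 1)]
    rw [show Finset.univ.filter (fun i : Fin (N + 1 + 1) => i < 0) = ∅ by simp, Finset.sum_empty,
      zero_add, ← Finset.sum_add_distrib, Finset.smul_sum]
    refine Finset.sum_congr rfl fun j _ => ?_
    have e : Finset.univ.filter (fun i => i < j.succ) =
        insert 0 ((Finset.univ.filter fun i => i < j).map (Fin.succEmb (N + 1))) := by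
      ext i
      refine Fin.cases ?_ (fun i => ?_) i <;> simp
    rw [e, Finset.sum_insert (by simp), Finset.sum_map, smul_add, Finset.smul_sum]
    congr 1
    · rw [smul_smul, ← pow_add, List.ofFn_succ]
      simp [add_comm 1, Function.comp_def]
    · refine Finset.sum_congr rfl fun i _ => ?_
      rw [smul_smul, ← pow_add, List.ofFn_succ]
      simp [add_comm 1, (Fin.succ_ne_zero _).symm]

end Single

/-! ### Comparison with the insertions of cochains -/

section Comparison

variable {K L : Type*} [Field K] [AddCommGroup L] [Module K L] {m : ℕ}

/-- A pre-cochain of degree `p` as a function on words, zero on the words of length `≠ p`. -/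
def toWord {p : ℕ} (f : PreCochain K L m p) (w : List (D K L m)) : Module.End K L :=
  if w.length = p then f fun i => w.getD i 0 else 0

theorem toWord_eq {p : ℕ} (f : PreCochain K L m p) {w : List (D K L m)} {Y : Fin p → D K L m}
    (hw : w.length = p) (hY : ∀ i : Fin p, w.getD i 0 = Y i) : toWord f w = f Y := by
  rw [toWord, if_pos hw]
  exact congrArg f (funext hY)

theorem toWord_ofFn {p : ℕ} (f : PreCochain K L m p) (Y : Fin p → D K L m) :
    toWord f (List.ofFn Y) = f Y :=
  toWord_eq f (by simp) fun i => by simp [List.getD_eq_getElem?_getD]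

theorem isWordAdditive_toWord {p : ℕ} (f : PreCochain K L m p) : IsWordAdditive (toWord f) := by
  intro l r
  by_cases h : l.length + (r.length + 1) = p
  · obtain ⟨Ψ, hΨ⟩ := slot_linear f (fun X i => (l ++ X :: r).getD i 0)
      ⟨l.length, by omega⟩ LinearMap.id (fun X => by simp [List.getD_eq_getElem?_getD])
      (fun X j hj => by
        have hj' : (j : ℕ) ≠ l.length := fun e => hj (Fin.ext e)
        simp only [List.getD_eq_getElem?_getD, List.getElem?_append, List.getElem?_cons]
        split_ifs with h₁ h₂
        · rfl
        · omega
        · rfl)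
    exact ⟨Ψ.toAddMonoidHom, fun X => by
      rw [toWord, if_pos (by simpa using h), hΨ]; rfl⟩
  · exact ⟨0, fun X => by rw [toWord, if_neg (by simpa using h)]; rfl⟩

variable (A : NHomLeibniz K L m)

theorem isEquivariant_toWord {p : ℕ} {f : PreCochain K L m p} (hf : f ∈ A.cochains p) :
    A.IsEquivariant (toWord f) := by
  intro a
  by_cases h : a.length = p
  · rw [toWord_eq f h fun _ => rfl, toWord_eq f (by simpa using h)
      (Y := fun i => A.αbar (a.getD i 0)) fun i => by
        rw [← List.getD_map _ _ A.αbar, map_zero]]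
    exact hf _
  · rw [toWord, if_neg h, toWord, if_neg (by simpa using h), mul_zero, zero_mul]

/-- The insertion `i_f(g)` of cochains is the insertion of the functions on words. -/
theorem iFun_eq_ins {p q N : ℕ} (h : p + q = N) (f : PreCochain K L m p) (g : PreCochain K L m q)
    (X : Fin N → D K L m) :
    A.iFun h f g X = A.ins q (toWord f) (toWord g) (List.ofFn X) := by
  subst h
  have h₀ : ∀ Y : Fin (p + q) → D K L m, A.circZero rfl f g Y =
      toWord f (((List.ofFn Y).drop q).map (A.αbar ^ q)) * toWord g ((List.ofFn Y).take q) := by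
    intro Y
    rw [toWord_eq f (Y := fun j => (A.αbar ^ q) (Y ⟨q + j, by omega⟩)) (by simp) fun i => ?_,
      toWord_eq g (Y := fun j => Y ⟨j, by omega⟩) (by simp) fun i => ?_]
    · rfl
    · rw [List.getD_eq_getElem _ _ (by simp)]; simp
    · rw [List.getD_eq_getElem _ _ (by simp)]; simp
  have h₁ : ∀ (k : Fin p) (Y : Fin (p + q) → D K L m), A.circSucc rfl f g k Y =
      toWord f (((List.ofFn Y).take k).map (A.αbar ^ q) ++
        insertion (A.α ^ q) (toWord g (((List.ofFn Y).drop (k + 1)).take q))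
          ((List.ofFn Y).getD k 0) ::
        ((List.ofFn Y).drop (k + 1 + q)).map (A.αbar ^ q)) * A.α ^ q := by
    intro k Y
    rw [toWord_eq g (Y := fun l => Y ⟨(k : ℕ) + 1 + l, by omega⟩) (by simp; omega) fun i => by
      rw [List.getD_eq_getElem _ _ (by simp; omega)]; simp]
    refine congrArg (· * A.α ^ q) (toWord_eq f (by simp; omega) fun i => ?_).symm
    have hk : min (k : ℕ) (p + q) = k := by omega
    rw [List.getD_eq_getElem _ _ (by simp; omega), List.getElem_append]
    simp only [List.length_map, List.length_take, List.length_ofFn, hk, List.getElem_map,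
      List.getElem_take, List.getElem_ofFn, List.getElem_cons, List.getElem_drop, Fin.lt_def,
      Fin.ext_iff]
    rcases lt_trichotomy (i : ℕ) k with c | c | c
    · rw [dif_pos c, if_pos c]
    · rw [dif_neg (by omega), dif_pos (by omega), if_neg (by omega), if_pos c,
        List.getD_eq_getElem _ _ (by simp; omega)]
      simp
    · rw [dif_neg (by omega), dif_neg (by omega), if_neg (by omega), if_neg (by omega)]
      exact congrArg _ (congrArg Y (Fin.ext (by simp only []; omega)))
  rw [iFun, Fin.sum_univ_succ, ins, wordIns, coder_eq_sum (p := p) (by simp), Finset.sum_mul]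
  congr 1
  · have := sum_shuffles (k := 0) (q := q) (by omega) X fun v =>
      toWord f ((v.drop q).map (A.αbar ^ q)) * toWord g (v.take q)
    rw [unshuffleFrom] at this
    simp only [Fin.val_zero, zero_mul, pow_zero, one_smul, circ, circBase, Fin.cases_zero, h₀]
    rw [this]
    congr 1; funext a b
    split_ifs with h
    · subst h; simp
    · rfl
  · refine Finset.sum_congr rfl fun k _ => ?_
    rw [smul_mul_assoc, ← sum_shuffles (by omega), Finset.sum_mul]
    simp only [circ, circBase, Fin.cases_succ, h₁, smul_mul_assoc]
    rfl

end Comparison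

variable {K L : Type*} [Field K] [AddCommGroup L] [Module K L] {m : ℕ}
variable (A : NHomLeibniz K L m)

theorem ins_congr {p q : ℕ} {f f' g g' : List (D K L m) → Module.End K L}
    (hf : ∀ v, v.length = p → f v = f' v) (hg : ∀ v, v.length = q → g v = g' v)
    {w : List (D K L m)} (hw : w.length = p + q) : A.ins q f g w = A.ins q f' g' w := by
  rw [ins, ins, wordIns, wordIns, coder_congr_left fun a ha => by rw [hg a ha],
    coder_congr fun v hv => hf v (by omega)]
  congr 1
  refine unshuffle_congr fun a b hab => ?_
  split_ifs with ha
  · rw [hf _ (by rw [List.length_map]; omega), hg a ha]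
  · rfl

theorem ins_wordBr_left (p q r : ℕ) (f g h : List (D K L m) → Module.End K L)
    (w : List (D K L m)) :
    A.ins r (A.wordBr p q f g) h w =
      A.ins r (A.ins q f g) h w - (-1 : ℤ) ^ (p * q) • A.ins r (A.ins p g f) h w := by
  have e₁ : A.wordIns r h w (A.wordBr p q f g) = A.wordIns r h w (A.ins q f g) +
      (-(-1 : ℤ) ^ (p * q)) • A.wordIns r h w (A.ins p g f) := by
    rw [wordIns, wordIns, wordIns, ← coder_zsmul, ← coder_add]
    refine coder_congr fun v _ => ?_
    rw [wordBr, neg_smul, ← sub_eq_add_neg]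
  have e₂ : unshuffle w (fun a b => if a.length = r then
        A.wordBr p q f g (b.map (A.αbar ^ r)) * h a else 0) =
      unshuffle w (fun a b => if a.length = r then A.ins q f g (b.map (A.αbar ^ r)) * h a else 0) -
      (-1 : ℤ) ^ (p * q) • unshuffle w (fun a b => if a.length = r then
        A.ins p g f (b.map (A.αbar ^ r)) * h a else 0) := by
    rw [← unshuffle_zsmul, ← unshuffle_sub]
    congr 1; funext a b
    split_ifs
    · rw [wordBr, sub_mul, smul_mul_assoc]
    · simp
  rw [ins, e₁, e₂, ins, ins, add_mul, smul_mul_assoc, smul_add, neg_smul]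
  abel

/-! ### The graded Lie algebra of cochains -/

variable {A} in
theorem Γ_ext {p : ℕ} {f g : A.Γ p} (h : ∀ X, f.1 X = g.1 X) : f = g :=
  Subtype.ext (MultilinearMap.ext h)

theorem brN_apply_eq_iFun {p q N : ℕ} (h : p + q = N) (f : A.Γ p) (g : A.Γ q)
    (X : Fin N → D K L m) :
    (A.brN h f g).1 X = A.iFun h f.1 g.1 X +
      (-1 : ℤ) ^ (p * q + 1) • A.iFun ((Nat.add_comm q p).trans h) g.1 f.1 X := rfl

theorem brN_apply {p q N : ℕ} (h : p + q = N) (f : A.Γ p) (g : A.Γ q) (X : Fin N → D K L m) :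
    (A.brN h f g).1 X = A.wordBr p q (toWord f.1) (toWord g.1) (List.ofFn X) := by
  rw [brN_apply_eq_iFun, iFun_eq_ins, iFun_eq_ins, wordBr, pow_succ, mul_neg_one, neg_smul,
    sub_eq_add_neg]

theorem toWord_brN {p q N : ℕ} (h : p + q = N) (f : A.Γ p) (g : A.Γ q) {w : List (D K L m)}
    (hw : w.length = N) :
    toWord (A.brN h f g).1 w = A.wordBr p q (toWord f.1) (toWord g.1) w := by
  subst hw
  rw [toWord_eq _ rfl (Y := w.get) fun i => by simp [List.getD_eq_getElem?_getD], brN_apply,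
    List.ofFn_get]

/-- `f ∘ₖ g` depends on `g` through a linear function of the letter into which `g` is inserted. -/
theorem circSucc_eq {p q N : ℕ} (h : p + q = N) (f : PreCochain K L m p) (k' : Fin p)
    (X : Fin N → D K L m) : ∃ Ψ : D K L m →ₗ[K] Module.End K L, ∀ g : PreCochain K L m q,
      A.circSucc h f g k' X = Ψ (insertion (A.α ^ q)
        (g (fun l => X ⟨(k' : ℕ) + 1 + l, by omega⟩)) (X ⟨k', by omega⟩)) * A.α ^ q := by
  obtain ⟨Ψ, hΨ⟩ := slot_linear f (fun a j => if j < k' then (A.αbar ^ q) (X ⟨j, by omega⟩)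
    else if j = k' then a else (A.αbar ^ q) (X ⟨q + j, by omega⟩)) k' LinearMap.id
    (fun a => by simp) (fun a j hj => by simp [hj])
  exact ⟨Ψ, fun g => by rw [← hΨ]; rfl⟩

theorem iFun_add_left {p q N : ℕ} (h : p + q = N) (f f' : PreCochain K L m p)
    (g : PreCochain K L m q) (X : Fin N → D K L m) :
    A.iFun h (f + f') g X = A.iFun h f g X + A.iFun h f' g X := by
  have e : ∀ k Y, A.circBase h (f + f') g k Y = A.circBase h f g k Y + A.circBase h f' g k Y :=
    fun k Y => by
      refine Fin.cases ?_ (fun k' => ?_) k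
      · exact LinearMap.add_comp ..
      · exact LinearMap.add_comp ..
  simp only [iFun, circ, e, smul_add, Finset.sum_add_distrib]

theorem iFun_smul_left {p q N : ℕ} (h : p + q = N) (c : K) (f : PreCochain K L m p)
    (g : PreCochain K L m q) (X : Fin N → D K L m) :
    A.iFun h (c • f) g X = c • A.iFun h f g X := by
  have e : ∀ k Y, A.circBase h (c • f) g k Y = c • A.circBase h f g k Y :=
    fun k Y => by
      refine Fin.cases ?_ (fun k' => ?_) k
      · exact LinearMap.smul_comp ..
      · exact LinearMap.smul_comp ..
  simp only [iFun, circ, e, smul_comm _ c, Finset.smul_sum]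

theorem iFun_add_right {p q N : ℕ} (h : p + q = N) (f : PreCochain K L m p)
    (g g' : PreCochain K L m q) (X : Fin N → D K L m) :
    A.iFun h f (g + g') X = A.iFun h f g X + A.iFun h f g' X := by
  have e : ∀ k Y, A.circBase h f (g + g') k Y = A.circBase h f g k Y + A.circBase h f g' k Y :=
    fun k Y => by
      refine Fin.cases ?_ (fun k' => ?_) k
      · exact LinearMap.comp_add ..
      · obtain ⟨Ψ, hΨ⟩ := A.circSucc_eq h f k' Y
        simp only [circBase, Fin.cases_succ, hΨ, add_apply, map_add,
          LinearMap.add_apply, add_mul]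
  simp only [iFun, circ, e, smul_add, Finset.sum_add_distrib]

theorem iFun_smul_right {p q N : ℕ} (h : p + q = N) (c : K) (f : PreCochain K L m p)
    (g : PreCochain K L m q) (X : Fin N → D K L m) :
    A.iFun h f (c • g) X = c • A.iFun h f g X := by
  have e : ∀ k Y, A.circBase h f (c • g) k Y = c • A.circBase h f g k Y :=
    fun k Y => by
      refine Fin.cases ?_ (fun k' => ?_) k
      · exact LinearMap.comp_smul ..
      · obtain ⟨Ψ, hΨ⟩ := A.circSucc_eq h f k' Y
        simp only [circBase, Fin.cases_succ, hΨ, smul_apply, map_smul,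
          LinearMap.smul_apply, smul_mul_assoc]
  simp only [iFun, circ, e, smul_comm _ c, Finset.smul_sum]

/-- The bracket of cochains as a bilinear map. -/
def brNLin {p q N : ℕ} (h : p + q = N) : A.Γ p →ₗ[K] A.Γ q →ₗ[K] A.Γ N :=
  LinearMap.mk₂ K (A.brN h)
    (fun f f' g => Γ_ext fun X => by
      change _ = (A.brN h f g).1 X + (A.brN h f' g).1 X
      simp only [brN_apply_eq_iFun]
      change A.iFun h (f.1 + f'.1) g.1 X + _ • A.iFun _ g.1 (f.1 + f'.1) X = _
      rw [iFun_add_left, iFun_add_right, smul_add]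
      abel)
    (fun c f g => Γ_ext fun X => by
      change _ = c • (A.brN h f g).1 X
      simp only [brN_apply_eq_iFun]
      change A.iFun h (c • f.1) g.1 X + _ • A.iFun _ g.1 (c • f.1) X = _
      rw [iFun_smul_left, iFun_smul_right, smul_add, smul_comm c])
    (fun f g g' => Γ_ext fun X => by
      change _ = (A.brN h f g).1 X + (A.brN h f g').1 X
      simp only [brN_apply_eq_iFun]
      change A.iFun h f.1 (g.1 + g'.1) X + _ • A.iFun _ (g.1 + g'.1) f.1 X = _
      rw [iFun_add_left, iFun_add_right, smul_add]
      abel)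
    (fun c f g => Γ_ext fun X => by
      change _ = c • (A.brN h f g).1 X
      simp only [brN_apply_eq_iFun]
      change A.iFun h f.1 (c • g.1) X + _ • A.iFun _ (c • g.1) f.1 X = _
      rw [iFun_smul_left, iFun_smul_right, smul_add, smul_comm c])

theorem brNLin_apply {p q N : ℕ} (h : p + q = N) (f : A.Γ p) (g : A.Γ q) :
    A.brNLin h f g = A.brN h f g := rfl

theorem brN_antisymm {p q N : ℕ} (h : p + q = N) (h' : q + p = N) (f : A.Γ p) (g : A.Γ q) :
    A.brN h f g = -((-1 : ℤ) ^ (p * q) • A.brN h' g f) := by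
  refine Γ_ext fun X => ?_
  change _ = -((-1 : ℤ) ^ (p * q) • (A.brN h' g f).1 X)
  rw [brN_apply, brN_apply, wordBr, wordBr, mul_comm q p]
  rcases neg_one_pow_eq_or ℤ (p * q) with e | e <;> rw [e] <;> simp

/-- The graded Jacobi identity, with the degrees of the inner brackets given up to equality. -/
theorem brN_jacobi {p q r a b c N : ℕ} (ha : p + q = a) (hb : q + r = b) (hc : r + p = c)
    (h₁ : a + r = N) (h₂ : b + p = N) (h₃ : c + q = N) (f : A.Γ p) (g : A.Γ q) (h : A.Γ r) :
    (-1 : ℤ) ^ (p * r) • A.brN h₁ (A.brN ha f g) h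
      + (-1 : ℤ) ^ (q * p) • A.brN h₂ (A.brN hb g h) f
      + (-1 : ℤ) ^ (r * q) • A.brN h₃ (A.brN hc h f) g = 0 := by
  -- the expansion of a double bracket into double insertions
  have key : ∀ {p q r a N : ℕ} (ha : p + q = a) (h₁ : a + r = N) (f : A.Γ p) (g : A.Γ q)
      (h : A.Γ r) (X : Fin N → D K L m), (A.brN h₁ (A.brN ha f g) h).1 X =
        (A.ins r (A.ins q (toWord f.1) (toWord g.1)) (toWord h.1) (List.ofFn X) -
        (-1 : ℤ) ^ (p * q) •
          A.ins r (A.ins p (toWord g.1) (toWord f.1)) (toWord h.1) (List.ofFn X)) -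
        ((-1 : ℤ) ^ (p * r) * (-1 : ℤ) ^ (q * r)) •
          (A.ins q (A.ins p (toWord h.1) (toWord f.1)) (toWord g.1) (List.ofFn X) -
          (-1 : ℤ) ^ (p * q) •
            A.ins p (A.ins q (toWord h.1) (toWord g.1)) (toWord f.1) (List.ofFn X)) := by
    intro p q r a N ha h₁ f g h X
    subst ha
    have hX : (List.ofFn X).length = p + q + r := by rw [List.length_ofFn, h₁]
    rw [brN_apply, wordBr, A.ins_congr (fun v hv => A.toWord_brN rfl f g hv) (fun _ _ => rfl) hX,
      A.ins_congr (p := r) (fun _ _ => rfl) (fun v hv => A.toWord_brN rfl f g hv)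
        (hX.trans (add_comm _ _)), ins_wordBr_left,
      A.ins_wordBr (A.isEquivariant_toWord f.2) (A.isEquivariant_toWord g.2)
        (isWordAdditive_toWord h.1), add_mul, pow_add]
  refine Γ_ext fun X => ?_
  change (-1 : ℤ) ^ (p * r) • (A.brN h₁ (A.brN ha f g) h).1 X +
    (-1 : ℤ) ^ (q * p) • (A.brN h₂ (A.brN hb g h) f).1 X +
    (-1 : ℤ) ^ (r * q) • (A.brN h₃ (A.brN hc h f) g).1 X = 0
  rw [key, key, key, mul_comm q p, mul_comm r q, mul_comm r p]
  rcases neg_one_pow_eq_or ℤ (p * q) with e₁ | e₁ <;>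
  rcases neg_one_pow_eq_or ℤ (p * r) with e₂ | e₂ <;>
  rcases neg_one_pow_eq_or ℤ (q * r) with e₃ | e₃ <;>
  rw [e₁, e₂, e₃] <;> simp only [one_smul, neg_smul, mul_one, mul_neg, neg_neg] <;> abel

theorem isGradedLieBracket_brN :
    IsGradedLieBracket K (fun p => A.Γ p) (fun h f g => A.brN h f g) where
  add_left h f f' g := LinearMap.map_add₂ (A.brNLin h) f f' g
  smul_left h c f g := LinearMap.map_smul₂ (A.brNLin h) c f g
  add_right h f g g' := map_add (A.brNLin h f) g g'
  smul_right h c f g := map_smul (A.brNLin h f) c g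
  antisymm h h' f g := A.brN_antisymm h h' f g
  jacobi h₁ h₂ h₃ f g h := A.brN_jacobi rfl rfl rfl h₁ h₂ h₃ f g h

/-! ### The coboundary as a bracket -/

/-- The multiplication `(z, X) ↦ [z, X]` as a cochain. -/
def mulCochain : A.Γ 1 :=
  Subtype.mk (MultilinearMap.ofSubsingleton K (D K L m) (Module.End K L) 0 A.ad)
    fun X => A.α_comp_ad (X 0)

theorem toWord_mulCochain (x : D K L m) : toWord A.mulCochain.1 [x] = A.ad x :=
  toWord_eq A.mulCochain.1 (Y := fun _ => x) rfl fun i => by simp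

/-- The Hom-Leibniz identity in terms of the operators `ad X`. -/
theorem ad_αbar_mul_ad (x y : D K L m) :
    A.ad (A.αbar y) * A.ad x = A.ad (A.αbar x) * A.ad y + A.ad (A.brD x y) * A.α := by
  induction x using PiTensorProduct.induction_on with
  | add x x' hx hx' =>
    simp only [brD, map_add, mul_add, add_mul] at hx hx' ⊢
    rw [hx, hx']
    abel
  | smul_tprod r x =>
    induction y using PiTensorProduct.induction_on with
    | add y y' hy hy' =>
      simp only [brD, map_add, mul_add, add_mul, LinearMap.add_apply] at hy hy' ⊢
      rw [hy, hy']
      abel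
    | smul_tprod s y =>
      have key : A.ad (A.αbar (PiTensorProduct.tprod K y)) * A.ad (PiTensorProduct.tprod K x) =
          A.ad (A.αbar (PiTensorProduct.tprod K x)) * A.ad (PiTensorProduct.tprod K y) +
          A.ad (A.brD (PiTensorProduct.tprod K x) (PiTensorProduct.tprod K y)) * A.α := by
        refine LinearMap.ext fun z => ?_
        have h := A.leibniz (Fin.cons z x) y
        rw [Fin.sum_univ_succ] at h
        simp only [LinearMap.add_apply, Module.End.mul_apply, brD, insertion_tprod, map_sum,
          LinearMap.sum_apply, αbar, PiTensorProduct.map_tprod, ad_tprod]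
        refine h.trans (congrArg₂ (· + ·) (congrArg _ ?_)
          (Finset.sum_congr rfl fun s _ => congrArg _ ?_))
        · funext i
          refine Fin.cases ?_ (fun i => ?_) i <;> simp
        · funext i
          refine Fin.cases ?_ (fun i => ?_) i
          · simp [Function.update_of_ne (Fin.succ_ne_zero s).symm]
          · by_cases his : i = s
            · subst his; simp
            · simp [his]
      simp only [brD, map_smul, LinearMap.smul_apply, smul_mul_assoc, mul_smul_comm] at key ⊢
      rw [key, smul_add, smul_add, smul_comm s r]

theorem ins_mulCochain_mulCochain (x y : D K L m) :
    A.ins 1 (toWord A.mulCochain.1) (toWord A.mulCochain.1) [x, y] = 0 := by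
  have h := A.ad_αbar_mul_ad x y
  rw [brD] at h
  simp [ins, wordIns, unshuffle, coder, toWord_mulCochain, h]

theorem brN_mulCochain_mulCochain {N : ℕ} (h : 1 + 1 = N) :
    A.brN h A.mulCochain A.mulCochain = 0 := by
  subst h
  refine Γ_ext fun X => ?_
  rw [brN_apply, wordBr]
  have : List.ofFn X = [X 0, X 1] := by simp [List.ofFn_succ]
  rw [this, ins_mulCochain_mulCochain, smul_zero, sub_zero]
  rfl

/-- The coboundary is, up to sign, the bracket with the multiplication. -/
theorem δ_eq_neg_brN (p : ℕ) (f : A.Γ p) : A.δ p f = -A.brN rfl f A.mulCochain := by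
  refine Γ_ext fun X => ?_
  change A.dFun f.1 X = -(A.brN rfl f A.mulCochain).1 X
  have h₁ : A.ins 1 (toWord f.1) (toWord A.mulCochain.1) (List.ofFn X) =
      -((∑ j : Fin (p + 1), ∑ i ∈ Finset.univ.filter (fun i => i < j),
          (-1 : ℤ) ^ ((j : ℕ) + 1) • A.dTerm₁ f.1 i j X)
        + (∑ i : Fin (p + 1), (-1 : ℤ) ^ ((i : ℕ) + 1) • A.dTerm₂ f.1 i X)) := by
    rw [ins, wordIns, unshuffle_length_one, coder_one, add_comm]
    simp only [pow_succ _ (Fin.val _), mul_neg_one, neg_smul, Finset.sum_neg_distrib, neg_add,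
      neg_neg, Finset.sum_mul, smul_mul_assoc, toWord_mulCochain, toWord_ofFn, pow_one,
      List.map_ofFn]
    rfl
  have h₂ : A.ins p (toWord A.mulCochain.1) (toWord f.1) (List.ofFn X) =
      (-1 : ℤ) ^ p • ((∑ i : Fin (p + 1), (-1 : ℤ) ^ (((i : ℕ) + 1) + 1) • A.dTerm₃ f.1 i X)
        + A.dTerm₄ f.1 X) := by
    -- the complement of the `p` arguments of `f` is a single letter
    have e₁ : unshuffle (List.ofFn X) (fun a b => if a.length = p then
          toWord A.mulCochain.1 (b.map (A.αbar ^ p)) * toWord f.1 a else 0) =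
        unshuffle (List.ofFn X) (fun a b => if a.length = 1 then (-1 : ℤ) ^ p •
          (toWord A.mulCochain.1 (a.map (A.αbar ^ p)) * toWord f.1 b) else 0) := by
      rw [unshuffle_comm]
      refine unshuffle_congr fun a b hab => ?_
      rw [List.length_ofFn] at hab
      by_cases h : a.length = 1
      · rw [if_pos h, if_pos (by omega), h, one_mul, show b.length = p by omega]
      · rw [if_neg h, if_neg (by omega), smul_zero]
    -- only the first letter has `p` letters to its right
    have e₂ : A.wordIns p (toWord f.1) (List.ofFn X) (toWord A.mulCochain.1) = (-1 : ℤ) ^ p •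
        A.ad (insertion (A.α ^ p) (f.1 fun l => X l.succ) (X 0)) := by
      have := unshuffle_length_eq (List.ofFn fun i => X i.succ) fun a b =>
        toWord A.mulCochain.1
          (insertion (A.α ^ p) (toWord f.1 a) (X 0) :: b.map (A.αbar ^ p))
      rw [List.length_ofFn] at this
      rw [wordIns, List.ofFn_succ, coder, this, coder_eq_zero (by simp), add_zero, List.map_nil,
        toWord_mulCochain, toWord_ofFn]
    rw [ins, e₁, e₂, unshuffle_length_one, smul_add, Finset.smul_sum, smul_mul_assoc]
    congr 1
    refine Finset.sum_congr rfl fun i _ => ?_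
    rw [List.map_singleton, toWord_mulCochain, toWord_ofFn, smul_comm, add_assoc, pow_add]
    simp [dTerm₃, Module.End.mul_eq_comp]
  rw [brN_apply, wordBr, h₁, h₂, mul_one, smul_smul, ← pow_add, ← two_mul, pow_mul, dFun]
  simp only [neg_one_sq, one_pow, one_smul]
  abel

theorem δ_brN {p q : ℕ} (f : A.Γ p) (g : A.Γ q) :
    A.δ (p + q) (A.brN rfl f g) =
      (-1 : ℤ) ^ q • A.brN (Nat.add_right_comm p 1 q) (A.δ p f) g + A.brN rfl f (A.δ q g) := by
  have hJ := A.brN_jacobi (N := p + q + 1) rfl rfl (Nat.add_comm 1 p) rfl (by omega) (by omega)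
    f g A.mulCochain
  rw [A.brN_antisymm (q := p) (by omega) (by omega : p + (q + 1) = p + q + 1),
    A.brN_antisymm (Nat.add_comm 1 p) rfl A.mulCochain f] at hJ
  simp only [δ_eq_neg_brN, ← brNLin_apply, map_neg, LinearMap.neg_apply, map_zsmul,
    LinearMap.smul_apply, add_mul, one_mul, mul_one, pow_add, smul_neg, smul_smul] at hJ ⊢
  rw [mul_comm q p] at hJ
  change _ = _ + -(A.brNLin (p := p) (N := p + q + 1) rfl f (A.brNLin rfl g A.mulCochain))
  rcases neg_one_pow_eq_or ℤ (p * q) with e₁ | e₁ <;>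
  rcases neg_one_pow_eq_or ℤ p with e₂ | e₂ <;>
  rcases neg_one_pow_eq_or ℤ q with e₃ | e₃ <;>
  simp only [e₁, e₂, e₃, one_smul, neg_smul, mul_one, mul_neg, neg_neg] at hJ ⊢ <;>
  first
  | (rw [← sub_eq_zero, ← hJ]; abel1)
  | (rw [← sub_eq_zero, ← neg_eq_zero, ← hJ]; abel1)

/-- By the Jacobi identity, `2 δ δ f = ± [f, [π, π]] = 0`. -/
theorem δ_δ [CharZero K] {p : ℕ} (f : A.Γ p) : A.δ (p + 1) (A.δ p f) = 0 := by
  have hJ := A.brN_jacobi (N := p + 1 + 1) rfl rfl (Nat.add_comm 1 p) rfl (by omega) (by omega)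
    f A.mulCochain A.mulCochain
  rw [brN_mulCochain_mulCochain, A.brN_antisymm (Nat.add_comm 1 p) rfl A.mulCochain f] at hJ
  simp only [δ_eq_neg_brN, ← brNLin_apply, map_neg, LinearMap.neg_apply, map_zsmul,
    LinearMap.smul_apply, map_zero, LinearMap.zero_apply, smul_zero, one_mul, mul_one, pow_one,
    add_zero, neg_smul, one_smul, neg_neg] at hJ ⊢
  set T := A.brNLin (N := p + 1 + 1) rfl (A.brNLin rfl f A.mulCochain) A.mulCochain
  have h2 : (2 : K) • T = 0 := by
    rw [two_smul]
    rcases neg_one_pow_eq_or ℤ p with e | e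
    · simpa [e] using hJ
    · rw [← neg_eq_zero]; simpa [e] using hJ
  exact (smul_eq_zero.mp h2).resolve_left two_ne_zero

/-! ### Cohomology -/

theorem brN_mem_Z {p q N : ℕ} (h : p + q = N) {f : A.Γ p} {g : A.Γ q} (hf : f ∈ A.Z p)
    (hg : g ∈ A.Z q) : A.brN h f g ∈ A.Z N := by
  subst h
  rw [Z, LinearMap.mem_ker] at hf hg ⊢
  rw [δ_brN, hf, hg, ← brNLin_apply, ← brNLin_apply, map_zero, map_zero, LinearMap.zero_apply,
    smul_zero, add_zero]

theorem brN_mem_B_left {p q N : ℕ} (h : p + q = N) {f : A.Γ p} {g : A.Γ q} (hf : f ∈ A.B p)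
    (hg : g ∈ A.Z q) : A.brN h f g ∈ A.B N := by
  rcases p with _ | p
  · rw [(Submodule.mem_bot K).mp hf, ← brNLin_apply, map_zero, LinearMap.zero_apply]
    exact zero_mem _
  · obtain ⟨M, hM, rfl⟩ : ∃ M, p + q = M ∧ M + 1 = N := ⟨p + q, rfl, by omega⟩
    subst hM
    obtain ⟨f, rfl⟩ := hf
    rw [Z, LinearMap.mem_ker] at hg
    have key := A.δ_brN f g
    have hz : A.brN (p := p) (N := p + q + 1) rfl f (0 : A.Γ (q + 1)) = 0 :=
      map_zero (A.brNLin (p := p) (N := p + q + 1) rfl f)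
    rw [hg, hz, add_zero] at key
    have e : A.brN h (A.δ p f) g = A.δ (p + q) ((-1 : ℤ) ^ q • A.brN rfl f g) := by
      rw [map_zsmul, key, smul_smul, ← pow_add, ← two_mul, pow_mul,
        neg_one_sq, one_pow, one_smul]
    exact ⟨_, e.symm⟩

theorem brN_mem_B_right {p q N : ℕ} (h : p + q = N) {f : A.Γ p} {g : A.Γ q} (hf : f ∈ A.Z p)
    (hg : g ∈ A.B q) : A.brN h f g ∈ A.B N := by
  rw [A.brN_antisymm h ((Nat.add_comm q p).trans h)]
  exact neg_mem (zsmul_mem (A.brN_mem_B_left _ hg hf) _)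

theorem cls_eq_cls_iff {p : ℕ} {f f' : A.Γ p} (hf : f ∈ A.Z p) (hf' : f' ∈ A.Z p) :
    A.cls f hf = A.cls f' hf' ↔ f - f' ∈ A.B p :=
  Submodule.Quotient.eq _

theorem exists_cls_eq {p : ℕ} (x : A.H p) : ∃ (f : A.Γ p) (hf : f ∈ A.Z p), A.cls f hf = x := by
  obtain ⟨⟨f, hf⟩, rfl⟩ := Submodule.Quotient.mk_surjective _ x
  exact ⟨f, hf, rfl⟩

/-- The bracket induced on cohomology. -/
def brH {p q N : ℕ} (h : p + q = N) (x : A.H p) (y : A.H q) : A.H N :=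
  Quotient.liftOn₂' x y (fun f g => A.cls (A.brN h f.1 g.1) (A.brN_mem_Z h f.2 g.2))
    fun f g f' g' hf hg => by
      have hf' : f.1 - f'.1 ∈ A.B p :=
        show f - f' ∈ (A.B p).submoduleOf (A.Z p) from (Submodule.quotientRel_def _).mp hf
      have hg' : g.1 - g'.1 ∈ A.B q :=
        show g - g' ∈ (A.B q).submoduleOf (A.Z q) from (Submodule.quotientRel_def _).mp hg
      rw [cls_eq_cls_iff]
      have e : A.brN h f.1 g.1 - A.brN h f'.1 g'.1 =
          A.brN h (f.1 - f'.1) g.1 + A.brN h f'.1 (g.1 - g'.1) := by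
        simp only [← brNLin_apply, map_sub, LinearMap.sub_apply]
        abel
      rw [e]
      exact add_mem (A.brN_mem_B_left h hf' g.2) (A.brN_mem_B_right h f'.2 hg')

theorem brH_cls {p q N : ℕ} (h : p + q = N) {f : A.Γ p} {g : A.Γ q} (hf : f ∈ A.Z p)
    (hg : g ∈ A.Z q) :
    A.brH h (A.cls f hf) (A.cls g hg) = A.cls (A.brN h f g) (A.brN_mem_Z h hf hg) := rfl

theorem isGradedLieBracket_brH : IsGradedLieBracket K A.H (fun h x y => A.brH h x y) where
  add_left h x x' y := by
    obtain ⟨f, hf, rfl⟩ := A.exists_cls_eq x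
    obtain ⟨f', hf', rfl⟩ := A.exists_cls_eq x'
    obtain ⟨g, hg, rfl⟩ := A.exists_cls_eq y
    exact congrArg Submodule.Quotient.mk
      (Subtype.ext (A.isGradedLieBracket_brN.add_left h f f' g))
  smul_left h c x y := by
    obtain ⟨f, hf, rfl⟩ := A.exists_cls_eq x
    obtain ⟨g, hg, rfl⟩ := A.exists_cls_eq y
    exact congrArg Submodule.Quotient.mk
      (Subtype.ext (A.isGradedLieBracket_brN.smul_left h c f g))
  add_right h x y y' := by
    obtain ⟨f, hf, rfl⟩ := A.exists_cls_eq x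
    obtain ⟨g, hg, rfl⟩ := A.exists_cls_eq y
    obtain ⟨g', hg', rfl⟩ := A.exists_cls_eq y'
    exact congrArg Submodule.Quotient.mk
      (Subtype.ext (A.isGradedLieBracket_brN.add_right h f g g'))
  smul_right h c x y := by
    obtain ⟨f, hf, rfl⟩ := A.exists_cls_eq x
    obtain ⟨g, hg, rfl⟩ := A.exists_cls_eq y
    exact congrArg Submodule.Quotient.mk
      (Subtype.ext (A.isGradedLieBracket_brN.smul_right h c f g))
  antisymm h h' x y := by
    obtain ⟨f, hf, rfl⟩ := A.exists_cls_eq x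
    obtain ⟨g, hg, rfl⟩ := A.exists_cls_eq y
    exact congrArg Submodule.Quotient.mk
      (Subtype.ext (A.isGradedLieBracket_brN.antisymm h h' f g))
  jacobi h₁ h₂ h₃ x y z := by
    obtain ⟨f, hf, rfl⟩ := A.exists_cls_eq x
    obtain ⟨g, hg, rfl⟩ := A.exists_cls_eq y
    obtain ⟨k, hk, rfl⟩ := A.exists_cls_eq z
    exact congrArg Submodule.Quotient.mk
      (Subtype.ext (A.isGradedLieBracket_brN.jacobi h₁ h₂ h₃ f g k))

end NHomLeibniz

end

theorem mainTheorem3 {K L : Type*} [Field K] [CharZero K] [AddCommGroup L] [Module K L]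
    (m : ℕ) (hm : 1 ≤ m) (A : NHomLeibniz K L m) (hα : Function.Injective A.α) :
    -- the bracket makes `Γ*(L)` a graded Lie algebra
    IsGradedLieBracket K (fun p => A.Γ p) (fun h f g => A.brN h f g) ∧
    -- `δ` squares to zero, and it is a derivation of the bracket
    (∀ (p : ℕ) (f : A.Γ p), A.δ (p + 1) (A.δ p f) = 0) ∧
    (∀ (p q : ℕ) (f : A.Γ p) (g : A.Γ q),
      A.δ (p + q) (A.brN rfl f g) =
        (-1 : ℤ) ^ q • A.brN (Nat.add_right_comm p 1 q) (A.δ p f) g + A.brN rfl f (A.δ q g)) ∧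
    -- the bracket descends to a graded Lie bracket on cohomology
    ∃ br : ∀ {p q N : ℕ}, p + q = N → A.H p → A.H q → A.H N,
      (∀ {p q N : ℕ} (h : p + q = N) (f : A.Γ p) (g : A.Γ q) (hf : f ∈ A.Z p) (hg : g ∈ A.Z q),
        ∃ hfg : A.brN h f g ∈ A.Z N,
          br h (A.cls f hf) (A.cls g hg) = A.cls (A.brN h f g) hfg) ∧
      IsGradedLieBracket K A.H br :=
  ⟨A.isGradedLieBracket_brN, fun _ f => A.δ_δ f, fun _ _ f g => A.δ_brN f g,
    fun h x y => A.brH h x y, fun h _ _ hf hg => ⟨A.brN_mem_Z h hf hg, A.brH_cls h hf hg⟩,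
    A.isGradedLieBracket_brH⟩
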